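/- **Setting.** Fix a covariate value $x$, a finite set $N$ of players, measurable spaces $\mathcal E_i$ of payoff types ($i\in N$), and the law $F$ of $\varepsilon=(\varepsilon_i)_{i\in N}$, a probability measure on $\mathcal E=\prod_i\mathcal E_i$. Every player $i$ knows his own payoff type $\varepsilon_i$ and in addition observes a signal. An information structure $S=(\mathcal T,P_{\tau\mid\varepsilon})$ consists of finite signal sets $\mathcal T_i$ and a probability kernel $P_{\tau\mid\varepsilon}$ from $\mathcal E$ to $\mathcal T=\prod_i\mathcal T_i$. A game $G$ consists of finite action sets $Y_i$, with $Y=\prod_i Y_i$, and payoffs $\pi_i:Y\times\mathcal E_i\to\mathbb R$ that are measurable in $\varepsilon_i$. A *Bayes correlated equilibrium* (BCE) of $(G,S)$ is a probability measure $\nu$ on $Y\times\mathcal E\times\mathcal T$ whose marginal on $\mathcal E\times\mathcal T$ is $P_{\tau\mid\varepsilon}(d\tau\mid\varepsilon)F(d\varepsilon)$ and which is incentive compatible: for every $i$, $\nu$-almost surely, for all $y_i'\in Y_i$, $$E_\nu[\pi_i(y_i,y_{-i},\varepsilon_i)\mid y_i,\varepsilon_i,\tau_i]\ \ge\ E_\nu[\pi_i(y_i',y_{-i},\varepsilon_i)\mid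 y_i,\varepsilon_i,\tau_i],$$ where the expectation is over $y_{-i}$ under its conditional distribution given $(y_i,\varepsilon_i,\tau_i)$. The set $Q^{BCE}_{G,S}$ of BCE predictions consists of the marginals on $Y$ of the BCE of $(G,S)$. A *combination* of $S^1$ and $S^2$ is a probability kernel $P^*$ from $\mathcal E$ to $\prod_i(\mathcal T^1_i\times\mathcal T^2_i)$ whose marginals on $\mathcal T^1$ and $\mathcal T^2$ are, for every $\varepsilon$, $P^1_{\tau\mid\varepsilon}$ and $P^2_{\tau\mid\varepsilon}$. $S^1$ is *individually sufficient* for $S^2$ if there is a combination such that, under $F(d\varepsilon)P^*(d\tau^1,d\tau^2\mid\varepsilon)$, for every $i$ and $A\subseteq\mathcal T^2_i$, $$P^*(\tau_i^2\in A\mid\tau_i^1,\tau_{-i}^1,\varepsilon)=P^*(\tau^2_i\in A\mid\tau_i^1)\quad\text{a.s.}$$ It is *individually sufficient for $S^2$ given own payoff types* if the same holds with $P^*(\tau^2_i\in A\mid\tau_i^1,\varepsilon_i)$ on the right-hand side. **Proposition.** For all information structures $S^1$ and $S^2$: 1. $S^1$ is individually sufficient for $S^2$ given own payoff types if and only if $Q^{BCE}_{G,S^1}\subseteq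 Q^{BCE}_{G,S^2}$ for every game $G$. 2. If $S^1$ is individually sufficient for $S^2$, then $Q^{BCE}_{G,S^1}\subseteq Q^{BCE}_{G,S^2}$ for every game $G$. 3. If the signals of $S^1$ reveal own payoff types (for every $i$, $\varepsilon_i$ is almost surely a function of $\tau_i^1$), then $S^1$ is individually sufficient for $S^2$ if and only if $Q^{BCE}_{G,S^1}\subseteq Q^{BCE}_{G,S^2}$ for every game $G$. -/

import Mathlib

open MeasureTheory ProbabilityTheory
open scoped BigOperators

noncomputable section

/-- An information structure (at a given covariate value) for players `N` with payoff types in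
`∏ i, E i`: a finite signal set `T i` for every player, and a probability kernel giving the
distribution of the signal profile conditional on the profile of payoff types. -/
structure InfoStructure (N : Type*) (E : N → Type*) [∀ i, MeasurableSpace (E i)] where
  /-- The signal set of each player. -/
  T : N → Type*
  /-- Signal sets are finite. -/
  fintypeT : ∀ i, Fintype (T i)
  /-- The σ-algebra on each signal set. -/
  measT : ∀ i, MeasurableSpace (T i)
  /-- Every subset of a finite signal set is measurable. -/
  discreteT : ∀ i, DiscreteMeasurableSpace (T i)
  /-- The conditional law of the signal profile given the payoff types. -/
  law : Kernel (∀ i, E i) (∀ i, T i)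
  /-- It is a probability kernel. -/
  markov : IsMarkovKernel law

attribute [instance] InfoStructure.fintypeT InfoStructure.measT InfoStructure.discreteT
  InfoStructure.markov

/-- A (basic) game: a finite set of actions for every player, and for every player a payoff
depending on the action profile and on the player's own payoff type. -/
structure BasicGame (N : Type*) (E : N → Type*) [∀ i, MeasurableSpace (E i)] where
  /-- The action set of each player. -/
  Y : N → Type
  /-- Action sets are finite. -/
  fintypeY : ∀ i, Fintype (Y i)
  /-- The σ-algebra on each action set. -/
  measY : ∀ i, MeasurableSpace (Y i)
  /-- Every subset of a finite action set is measurable. -/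
  discreteY : ∀ i, DiscreteMeasurableSpace (Y i)
  /-- The payoff `payoff i y e` of player `i` at the action profile `y` and own type `e`. -/
  payoff : ∀ i, (∀ j, Y j) → E i → ℝ
  /-- Payoffs are measurable in the payoff type. -/
  measurable_payoff : ∀ i y, Measurable (payoff i y)

attribute [instance] BasicGame.fintypeY BasicGame.measY BasicGame.discreteY

section

variable {N : Type*} [Fintype N] [DecidableEq N] {E : N → Type*} [∀ i, MeasurableSpace (E i)]

/-- `K` is the kernel of a combination of `S₁` and `S₂`: player `i` receives a pair of signals in
`S₁.T i × S₂.T i`, and conditionally on every `ε` the marginals are those of `S₁` and `S₂`. -/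
structure IsCombination (S₁ S₂ : InfoStructure N E)
    (K : Kernel (∀ i, E i) (∀ i, S₁.T i × S₂.T i)) : Prop where
  markov : IsMarkovKernel K
  sum_right : ∀ (ε : ∀ i, E i) (t₁ : ∀ i, S₁.T i),
    ∑ t₂ : (∀ i, S₂.T i), K ε {fun i => (t₁ i, t₂ i)} = S₁.law ε {t₁}
  sum_left : ∀ (ε : ∀ i, E i) (t₂ : ∀ i, S₂.T i),
    ∑ t₁ : (∀ i, S₁.T i), K ε {fun i => (t₁ i, t₂ i)} = S₂.law ε {t₂}

/-- Individual sufficiency: there is a combination of `S₁` and `S₂` under which, for every player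
`i` and every set `A` of signals, `P(τ²ᵢ ∈ A | τ¹, ε) = P(τ²ᵢ ∈ A | τ¹ᵢ)` almost surely, where `ε`
has law `F`. -/
def IndividuallySufficient (F : Measure (∀ i, E i)) (S₁ S₂ : InfoStructure N E) : Prop :=
  ∃ K : Kernel (∀ i, E i) (∀ i, S₁.T i × S₂.T i), IsCombination S₁ S₂ K ∧
    ∀ (i : N) (A : Set (S₂.T i)),
      (F ⊗ₘ K)⟦{w : (∀ j, E j) × (∀ j, S₁.T j × S₂.T j) | (w.2 i).2 ∈ A} |
          MeasurableSpace.comap (fun w => ((fun j => (w.2 j).1 : ∀ j, S₁.T j), w.1))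
            inferInstance⟧
        =ᵐ[F ⊗ₘ K]
      (F ⊗ₘ K)⟦{w : (∀ j, E j) × (∀ j, S₁.T j × S₂.T j) | (w.2 i).2 ∈ A} |
          MeasurableSpace.comap (fun w => (w.2 i).1) inferInstance⟧

/-- Individual sufficiency when every player also knows the own payoff type, so that the
information of player `i` under `S₁` is `(τ¹ᵢ, εᵢ)`: there is a combination under which
`P(τ²ᵢ ∈ A | τ¹, ε) = P(τ²ᵢ ∈ A | τ¹ᵢ, εᵢ)` almost surely. -/
def IndividuallySufficientOwnType (F : Measure (∀ i, E i)) (S₁ S₂ : InfoStructure N E) : Prop :=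
  ∃ K : Kernel (∀ i, E i) (∀ i, S₁.T i × S₂.T i), IsCombination S₁ S₂ K ∧
    ∀ (i : N) (A : Set (S₂.T i)),
      (F ⊗ₘ K)⟦{w : (∀ j, E j) × (∀ j, S₁.T j × S₂.T j) | (w.2 i).2 ∈ A} |
          MeasurableSpace.comap (fun w => ((fun j => (w.2 j).1 : ∀ j, S₁.T j), w.1))
            inferInstance⟧
        =ᵐ[F ⊗ₘ K]
      (F ⊗ₘ K)⟦{w : (∀ j, E j) × (∀ j, S₁.T j × S₂.T j) | (w.2 i).2 ∈ A} |
          MeasurableSpace.comap (fun w => ((w.2 i).1, w.1 i)) inferInstance⟧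

/-- Under `S`, the signal of every player reveals the player's own payoff type: almost surely,
`εᵢ` is a function of `τᵢ`. -/
def RevealsOwnType (F : Measure (∀ i, E i)) (S : InfoStructure N E) : Prop :=
  ∀ i, ∃ g : S.T i → E i, ∀ᵐ w ∂(F ⊗ₘ S.law), w.1 i = g (w.2 i)

/-- Outcomes of a game with an information structure: an action profile, a profile of payoff
types and a profile of signals. -/
abbrev Outcome (G : BasicGame N E) (S : InfoStructure N E) : Type _ :=
  (∀ i, G.Y i) × (∀ i, E i) × (∀ i, S.T i)

/-- The conditional probability under `ν` of the action profile `z`, given the own action, own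
payoff type and own signal `(yᵢ, εᵢ, τᵢ)` of player `i`. -/
def condActionProb (G : BasicGame N E) (S : InfoStructure N E) (ν : Measure (Outcome G S))
    (i : N) (z : ∀ j, G.Y j) : Outcome G S → ℝ :=
  ν⟦{w : Outcome G S | w.1 = z} |
    MeasurableSpace.comap (fun w : Outcome G S => (w.1 i, w.2.1 i, w.2.2 i)) inferInstance⟧

/-- The conditional expected payoff `E_ν[πᵢ(a, y₋ᵢ, εᵢ) | yᵢ, εᵢ, τᵢ]` of player `i` from the
action `a`. As `εᵢ` is given and there are finitely many action profiles, it is the finite sum of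
the payoffs weighted with the conditional probabilities of the action profiles. -/
def condPayoff (G : BasicGame N E) (S : InfoStructure N E) (ν : Measure (Outcome G S))
    (i : N) (a : G.Y i) (w : Outcome G S) : ℝ :=
  ∑ z : (∀ j, G.Y j), condActionProb G S ν i z w * G.payoff i (Function.update z i a) (w.2.1 i)

/-- Bayes correlated equilibrium of the game `G` with prior `F` and information structure `S`. -/
structure IsBCE (F : Measure (∀ i, E i)) (G : BasicGame N E) (S : InfoStructure N E)
    (ν : Measure (Outcome G S)) : Prop where
  prob : IsProbabilityMeasure ν
  /-- Consistency with the prior. -/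
  consistent : ν.map Prod.snd = F ⊗ₘ S.law
  /-- Incentive compatibility. -/
  incentive : ∀ i : N, ∀ᵐ w ∂ν, ∀ a : G.Y i,
    condPayoff G S ν i a w ≤ condPayoff G S ν i (w.1 i) w

/-- The set of BCE predictions: the distributions of the action profile in some BCE. -/
def bcePredictions (F : Measure (∀ i, E i)) (G : BasicGame N E) (S : InfoStructure N E) :
    Set ((∀ i, G.Y i) → ℝ) :=
  {q | q ∈ stdSimplex ℝ (∀ i, G.Y i) ∧
    ∃ ν : Measure (Outcome G S), IsBCE F G S ν ∧ ∀ y, q y = ν.real {w | w.1 = y}}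

end

end

/-!
The proof passes from conditional expected payoffs to an integrated form of incentive compatibility,
`Obedient`: against test functions of the own payoff type, no deviation has a positive integral
(`incentive_iff_obedient`). This form is stable under renaming actions, mixing, and averaging.

*Sufficiency implies inclusion* (`bcePredictions_subset_of_ownType`). Given a BCE under `S₁` and a
combination, draw the signals of `S₂` from the combination conditionally on types and `S₁`-signals,
independently of the actions. The signal `τ²ᵢ` then carries no information on actions, types and
`S₁`-signals beyond `(τ¹ᵢ, εᵢ)`, so an obedience integral for the signal `τ²ᵢ` is a sum of obedience
integrals for the signals `τ¹ᵢ`, with the conditional probability `g(τ¹ᵢ, εᵢ)` of `τ²ᵢ` as a weight.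

*Inclusion implies sufficiency* (`ownType_of_bcePredictions_subset`). Predictions only record the
actions, so the game must make the actions reveal the types. Given finitely many rectangles in the
space of type profiles, every player reports which sides contain the own type, which is strictly
dominant to do truthfully, and reports a signal of `S₁`. The payoff scores, by the quadratic rule,
the forecasts of the opponents' reports that go with the exact own type and the reported signal;
since the rule is proper, truth is obedient under `S₁` (`Report.obedient_truth`). Further actions
shift one forecast by `±δ`. They are never used, but an equilibrium under `S₂` with the truthful
prediction must not gain by them, and so given `(εᵢ, τ²ᵢ)` and the report, the forecasts are correct
up to `δ / 2` (`Report.abs_setIntegral_forecast_error_le`). The laws of types, reported signals and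
`S₂`-signals so obtained are dominated by one finite measure, and along an ultrafilter they converge
setwise to a measure (`exists_measure_tendsto_of_le`) under which all forecasts are exact. As the
forecasts do not involve `τ²ᵢ`, this is the required conditional independence; disintegrating the
limit over the types yields the combination. No regularity of the type spaces is used: only the
finite signals are disintegrated.

Individual sufficiency implies the version with own types, since conditioning on `(τ¹ᵢ, εᵢ)` lies
between conditioning on `τ¹ᵢ` and on `(τ¹, ε)`. If `εᵢ` is a function of `τ¹ᵢ`, the two agree.
-/

open Filter Topology

set_option linter.unusedSectionVars false

/-! ### Conditional probabilities as functions of the conditioning variable -/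

section CondProb

variable {W X : Type*} [mW : MeasurableSpace W] [mX : MeasurableSpace X]
  {μ : Measure W} [IsFiniteMeasure μ] {I : W → X} {s : Set W}

/-- A conditional probability given `I` is a measurable function `q` of `I`. Clipping makes the
bounds `0 ≤ q ≤ 1` hold everywhere, not only almost everywhere. -/
theorem exists_measurable_comp_eq_condProb (hI : Measurable I) (hs : MeasurableSet s) :
    ∃ q : X → ℝ, Measurable q ∧ (∀ x, 0 ≤ q x) ∧ (∀ x, q x ≤ 1) ∧
      μ⟦s | mX.comap I⟧ =ᵐ[μ] fun w => q (I w) := by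
  have hm : mX.comap I ≤ mW := hI.comap_le
  obtain ⟨h, hh, hcomp⟩ := (stronglyMeasurable_condExp (m := mX.comap I) (μ := μ)
    (f := s.indicator fun _ => (1 : ℝ))).exists_eq_measurable_comp
  refine ⟨fun x => max 0 (min 1 (h x)), by have := hh.measurable; fun_prop,
    fun x => by simp, fun x => by simp, ?_⟩
  have h0 : 0 ≤ᵐ[μ] μ⟦s | mX.comap I⟧ :=
    condExp_nonneg (ae_of_all _ fun w => Set.indicator_nonneg (fun _ _ => zero_le_one) w)
  have h1 : μ⟦s | mX.comap I⟧ ≤ᵐ[μ] fun _ => (1 : ℝ) := by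
    have h := condExp_mono (m := mX.comap I) (μ := μ) (f := s.indicator fun _ => (1 : ℝ))
      ((integrable_const _).indicator hs) (integrable_const (1 : ℝ))
      (ae_of_all _ fun w => Set.indicator_le_self' (fun _ _ => zero_le_one) w)
    rwa [condExp_const hm] at h
  filter_upwards [h0, h1] with w h0 h1
  rw [hcomp] at h0 h1 ⊢
  simp only [Function.comp_apply, Pi.zero_apply] at h0 h1 ⊢
  rw [min_eq_right h1, max_eq_right h0]

/-- Pull-out property: under the integral, the indicator of `s` may be replaced by the conditional
probability of `s` given `I` when the other factor is a function of `I`. -/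
theorem setIntegral_comp_eq_integral_mul_condProb (hI : Measurable I) (hs : MeasurableSet s)
    {q : X → ℝ} (hq : μ⟦s | mX.comap I⟧ =ᵐ[μ] fun w => q (I w)) {ψ : X → ℝ} (hψ : Measurable ψ)
    (hb : ∃ C, ∀ x, |ψ x| ≤ C) :
    ∫ w in s, ψ (I w) ∂μ = ∫ w, ψ (I w) * q (I w) ∂μ := by
  obtain ⟨C, hC⟩ := hb
  have hm : mX.comap I ≤ mW := hI.comap_le
  have hψm : StronglyMeasurable[mX.comap I] fun w => ψ (I w) :=
    (hψ.comp (comap_measurable I)).stronglyMeasurable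
  have h := condExp_stronglyMeasurable_mul_of_bound hm hψm
    (g := s.indicator fun _ => (1 : ℝ)) ((integrable_const _).indicator hs) C
    (ae_of_all μ fun w => by simpa using hC (I w))
  rw [← integral_indicator hs]
  calc ∫ w, s.indicator (fun w => ψ (I w)) w ∂μ
      = ∫ w, ((fun w => ψ (I w)) * s.indicator fun _ => (1 : ℝ)) w ∂μ := by
        congr 1; ext w; by_cases hw : w ∈ s <;> simp [hw]
    _ = ∫ w, (μ[(fun w => ψ (I w)) * s.indicator fun _ => (1 : ℝ) | mX.comap I]) w ∂μ :=
        (integral_condExp hm).symm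
    _ = ∫ w, ψ (I w) * q (I w) ∂μ := by
        refine integral_congr_ae ?_
        filter_upwards [h, hq] with w h1 h2
        rw [h1, Pi.mul_apply, h2]

theorem condProb_ae_eq_of_forall_setIntegral_eq (hI : Measurable I) (hs : MeasurableSet s)
    {q : X → ℝ} (hq : Measurable q) (hb : ∃ C, ∀ x, |q x| ≤ C)
    (h : ∀ B : Set X, MeasurableSet B → ∫ w in I ⁻¹' B, q (I w) ∂μ = μ.real (s ∩ I ⁻¹' B)) :
    μ⟦s | mX.comap I⟧ =ᵐ[μ] fun w => q (I w) := by
  obtain ⟨C, hC⟩ := hb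
  have hm : mX.comap I ≤ mW := hI.comap_le
  symm
  refine ae_eq_condExp_of_forall_setIntegral_eq hm ((integrable_const _).indicator hs)
    (fun B _ _ => ?_) ?_ ?_
  · exact (Integrable.of_bound (hq.comp hI).aestronglyMeasurable C
      (ae_of_all _ fun w => by simpa using hC (I w))).integrableOn
  · rintro _ ⟨B, hB, rfl⟩ _
    rw [h B hB, integral_indicator hs, Measure.restrict_restrict hs]
    simp
  · exact (hq.comp (comap_measurable I)).stronglyMeasurable.aestronglyMeasurable

/-- If a conditional probability given `I` depends on a coarser variable `J ∘ I` only, then it is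
the conditional probability given that coarser variable. -/
theorem condProb_comp_ae_eq {X' : Type*} [mX' : MeasurableSpace X'] (hI : Measurable I)
    {J : W → X'} (hJI : mX'.comap J ≤ mX.comap I) {g : X' → ℝ} (hg : Measurable g)
    (h : μ⟦s | mX.comap I⟧ =ᵐ[μ] fun w => g (J w)) :
    μ⟦s | mX'.comap J⟧ =ᵐ[μ] fun w => g (J w) := by
  have hm : mX.comap I ≤ mW := hI.comap_le
  have h1 := condExp_condExp_of_le (μ := μ) (f := s.indicator fun _ => (1 : ℝ)) hJI hm
  have h2 : μ[μ⟦s | mX.comap I⟧ | mX'.comap J] =ᵐ[μ] μ[fun w => g (J w) | mX'.comap J] :=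
    condExp_congr_ae h
  have h3 : μ[fun w => g (J w) | mX'.comap J] = fun w => g (J w) :=
    condExp_of_stronglyMeasurable (hJI.trans hm)
      (hg.comp (comap_measurable J)).stronglyMeasurable
      ((integrable_congr h).1 integrable_condExp)
  rw [h3] at h2
  exact h1.symm.trans h2

end CondProb

/-! ### Setwise limits of dominated measures -/

section Limit

variable {W ι : Type*} [MeasurableSpace W]

/-- Along an ultrafilter, measures dominated by a fixed finite measure converge setwise. The limit
is finitely additive as a limit of measures, and the domination makes it countably additive. -/
theorem exists_measure_tendsto_of_le (M : Measure W) [IsFiniteMeasure M] (lam : ι → Measure W)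
    (hle : ∀ n, lam n ≤ M) (U : Ultrafilter ι) :
    ∃ L : Measure W, L ≤ M ∧
      ∀ C, MeasurableSet C → Tendsto (fun n => (lam n).real C) U (𝓝 (L.real C)) := by
  have hfin : ∀ n, IsFiniteMeasure (lam n) := fun n => isFiniteMeasure_of_le M (hle n)
  have hreal : ∀ n C, (lam n).real C ≤ M.real C := fun n C =>
    ENNReal.toReal_mono (measure_ne_top M C) (hle n C)
  have hex : ∀ C : Set W, ∃ x, 0 ≤ x ∧ x ≤ M.real C ∧
      Tendsto (fun n => (lam n).real C) U (𝓝 x) := fun C => by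
    obtain ⟨x, hx, hlim⟩ := (isCompact_Icc (a := (0 : ℝ)) (b := M.real C)).ultrafilter_le_nhds
      (U.map fun n => (lam n).real C)
      (by
        rw [le_principal_iff]
        exact mem_map.2 (Filter.univ_mem' fun n => ⟨measureReal_nonneg, hreal n C⟩))
    exact ⟨x, hx.1, hx.2, hlim⟩
  choose l hl0 hlM hlim using hex
  have hadd : ∀ f : ℕ → Set W, (∀ k, MeasurableSet (f k)) → Pairwise (Function.onFun Disjoint f) →
      HasSum (fun k => l (f k)) (l (⋃ k, f k)) := by
    intro f hf hd
    have hsum : Summable fun k => M.real (f k) := by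
      have := ENNReal.summable_toReal (f := fun k => M (f k))
        (by rw [← measure_iUnion hd hf]; exact measure_ne_top _ _)
      exact this
    -- Tannery's theorem: the masses of the pieces are dominated by those of `M`.
    have ht := tendsto_tsum_of_dominated_convergence (𝓕 := (U : Filter ι))
      (f := fun n k => (lam n).real (f k)) hsum (fun k => hlim (f k))
      (Eventually.of_forall fun n k => by
        rw [Real.norm_of_nonneg measureReal_nonneg]; exact hreal n _)
    have heq : ∀ n, ∑' k, (lam n).real (f k) = (lam n).real (⋃ k, f k) := fun n => by
      simp only [measureReal_def]
      rw [measure_iUnion hd hf, ENNReal.tsum_toReal_eq fun k => measure_ne_top _ _]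
    simp only [heq] at ht
    rw [tendsto_nhds_unique (hlim (⋃ k, f k)) ht]
    exact (Summable.of_nonneg_of_le (fun k => hl0 _) (fun k => hlM _) hsum).hasSum
  have hempty : l ∅ = 0 := le_antisymm (by simpa using hlM ∅) (hl0 ∅)
  let L : Measure W := Measure.ofMeasurable (fun C _ => ENNReal.ofReal (l C))
    (by simp [hempty]) (fun f hf hd => by
      have h := hadd f hf hd
      rw [← h.tsum_eq, ENNReal.ofReal_tsum_of_nonneg (fun k => hl0 _) h.summable])
  have hL : ∀ C, MeasurableSet C → L C = ENNReal.ofReal (l C) := fun C hC =>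
    Measure.ofMeasurable_apply C hC
  refine ⟨L, Measure.le_iff.2 fun C hC => ?_, fun C hC => ?_⟩
  · rw [hL C hC]
    exact ENNReal.ofReal_le_of_le_toReal (hlM C)
  · rw [measureReal_def, hL C hC, ENNReal.toReal_ofReal (hl0 C)]
    exact hlim C

/-- Setwise convergence under a finite dominating measure `M` gives convergence of the integrals of
every `M`-integrable function. -/
theorem tendsto_integral_of_tendsto_measureReal {M : Measure W} [IsFiniteMeasure M]
    {lam : ι → Measure W} (hle : ∀ n, lam n ≤ M) {L : Measure W} (hL : L ≤ M) {l : Filter ι}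
    (hlim : ∀ C, MeasurableSet C → Tendsto (fun n => (lam n).real C) l (𝓝 (L.real C)))
    {f : W → ℝ} (hf : Integrable f M) :
    Tendsto (fun n => ∫ w, f w ∂(lam n)) l (𝓝 (∫ w, f w ∂L)) := by
  have hfin : ∀ n, IsFiniteMeasure (lam n) := fun n => isFiniteMeasure_of_le M (hle n)
  have hfinL : IsFiniteMeasure L := isFiniteMeasure_of_le M hL
  -- Integration against any measure below `M` is nonexpansive on `L¹(M)`, so the set of integrands
  -- for which convergence holds is closed there.
  have key : ∀ (ν : Measure W), ν ≤ M → ∀ f g : W →₁[M] ℝ,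
      |∫ w, f w ∂ν - ∫ w, g w ∂ν| ≤ dist f g := fun ν hν f g => by
    have hf := (L1.integrable_coeFn f)
    have hg := (L1.integrable_coeFn g)
    rw [← integral_sub (hf.mono_measure hν) (hg.mono_measure hν), L1.dist_eq_integral_dist]
    refine (abs_integral_le_integral_abs).trans ?_
    refine integral_mono_measure hν (ae_of_all _ fun w => abs_nonneg _) ?_
    exact (hf.sub hg).abs
  refine Integrable.induction (μ := M)
    (fun f => Tendsto (fun n => ∫ w, f w ∂(lam n)) l (𝓝 (∫ w, f w ∂L))) ?_ ?_ ?_ ?_ hf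
  · intro c s hs _
    simp only [integral_indicator hs, setIntegral_const, smul_eq_mul]
    exact (hlim s hs).mul_const c
  · intro f g _ hf hg h1 h2
    have h := h1.add h2
    simp only [Pi.add_apply]
    rw [integral_add (hf.mono_measure hL) (hg.mono_measure hL)]
    refine h.congr fun n => ?_
    rw [integral_add (hf.mono_measure (hle n)) (hg.mono_measure (hle n))]
  · refine isClosed_of_closure_subset fun f hf => ?_
    rw [Metric.mem_closure_iff] at hf
    refine Metric.tendsto_nhds.2 fun ε hε => ?_
    obtain ⟨g, hg, hfg⟩ := hf (ε / 3) (by positivity)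
    filter_upwards [Metric.tendsto_nhds.1 hg (ε / 3) (by positivity)] with n hn
    have h1 := key (lam n) (hle n) f g
    have h2 := key L hL f g
    rw [Real.dist_eq] at hn ⊢
    rw [abs_lt] at hn ⊢
    rw [abs_le] at h1 h2
    constructor <;> linarith [hn.1, hn.2, h1.1, h1.2, h2.1, h2.2]
  · intro f g hfg _ h
    have h1 : ∀ ν : Measure W, ν ≤ M → ∫ w, f w ∂ν = ∫ w, g w ∂ν := fun ν hν =>
      integral_congr_ae (hfg.filter_mono (ae_mono hν))
    rw [← h1 L hL]
    exact h.congr fun n => h1 _ (hle n)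

end Limit

/-! ### Incentive compatibility in integrated form -/

section Obedience

variable {N : Type*} [Fintype N] [DecidableEq N] {E : N → Type*} [∀ i, MeasurableSpace (E i)]

/-- Incentive compatibility in integrated form, for a law `ν` of actions, payoff types and signals:
no player gains by a deviation from the action `b` to the action `a` at the signal `t`, weighted
with a test function `φ` of the own payoff type. Since payoffs need not be integrable, `φ` ranges
over the bounded test functions whose product with the payoffs is bounded. -/
def Obedient {A T : N → Type*} [∀ i, MeasurableSpace (A i)] [∀ i, MeasurableSpace (T i)]
    (pay : ∀ i, (∀ j, A j) → E i → ℝ) (ν : Measure ((∀ i, A i) × (∀ i, E i) × (∀ i, T i))) :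
    Prop :=
  ∀ (i : N) (a b : A i) (t : T i) (φ : E i → ℝ), Measurable φ → (∀ e, 0 ≤ φ e) →
    (∃ C, ∀ e, φ e ≤ C) → (∃ C, ∀ z e, φ e * |pay i z e| ≤ C) →
    ∫ w in {w | w.1 i = b ∧ w.2.2 i = t},
      φ (w.2.1 i) * (pay i (Function.update w.1 i a) (w.2.1 i) - pay i w.1 (w.2.1 i)) ∂ν ≤ 0

/-- The conditional gain of player `i` from playing `a` instead of `b` after the signal `t`, as a
function `d` of the own payoff type. -/
theorem exists_condPayoff_sub_eq (G : BasicGame N E) (S : InfoStructure N E)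
    (ν : Measure (Outcome G S)) [IsProbabilityMeasure ν] (i : N) (a b : G.Y i) (t : S.T i) :
    ∃ d : E i → ℝ, Measurable d ∧
      (∀ᵐ w ∂ν, w.1 i = b ∧ w.2.2 i = t →
        condPayoff G S ν i a w - condPayoff G S ν i b w = d (w.2.1 i)) ∧
      ∀ φ : E i → ℝ, Measurable φ → (∀ e, 0 ≤ φ e) →
        (∃ C, ∀ z e, φ e * |G.payoff i z e| ≤ C) →
        (∃ C, ∀ e, |φ e * d e| ≤ C) ∧
        ∫ w in {w | w.1 i = b ∧ w.2.2 i = t}, φ (w.2.1 i) *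
            (G.payoff i (Function.update w.1 i a) (w.2.1 i) - G.payoff i w.1 (w.2.1 i)) ∂ν =
          ∫ w in {w | w.1 i = b ∧ w.2.2 i = t}, φ (w.2.1 i) * d (w.2.1 i) ∂ν := by
  classical
  have hI : Measurable fun w : Outcome G S => (w.1 i, w.2.1 i, w.2.2 i) := by fun_prop
  have hz : ∀ z, MeasurableSet {w : Outcome G S | w.1 = z} := fun z =>
    measurable_fst (measurableSet_singleton z)
  have hB : MeasurableSet {w : Outcome G S | w.1 i = b ∧ w.2.2 i = t} :=
    MeasurableSet.inter
      ((by fun_prop : Measurable fun w : Outcome G S => w.1 i) (measurableSet_singleton b))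
      ((by fun_prop : Measurable fun w : Outcome G S => w.2.2 i) (measurableSet_singleton t))
  choose p hpm hp0 hp1 hp using fun z => exists_measurable_comp_eq_condProb (μ := ν) hI (hz z)
  let D : (∀ j, G.Y j) → E i → ℝ := fun z e =>
    G.payoff i (Function.update z i a) e - G.payoff i (Function.update z i b) e
  have hD : ∀ z, Measurable (D z) := fun z =>
    (G.measurable_payoff i _).sub (G.measurable_payoff i _)
  refine ⟨fun e => ∑ z, p z (b, e, t) * D z e, ?_, ?_, ?_⟩
  · refine Finset.measurable_sum _ fun z _ => ?_
    exact ((hpm z).comp (by fun_prop)).mul (hD z)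
  · filter_upwards [ae_all_iff.2 hp] with w hw hbt
    simp only [condPayoff, condActionProb, hw, ← Finset.sum_sub_distrib, ← mul_sub, hbt.1, hbt.2, D]
  · rintro φ hφ hφ0 ⟨C, hC⟩
    have hφD : ∀ z e, |φ e * D z e| ≤ C + C := fun z e => by
      rw [abs_mul, abs_of_nonneg (hφ0 e)]
      refine (mul_le_mul_of_nonneg_left (abs_sub _ _) (hφ0 e)).trans ?_
      rw [mul_add]
      exact add_le_add (hC _ _) (hC _ _)
    have hC0 : ∀ z e, 0 ≤ C + C := fun z e => (abs_nonneg _).trans (hφD z e)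
    refine ⟨⟨∑ z : (∀ j, G.Y j), (C + C), fun e => ?_⟩, ?_⟩
    · rw [Finset.mul_sum]
      refine (Finset.abs_sum_le_sum_abs _ _).trans (Finset.sum_le_sum fun z _ => ?_)
      rw [mul_left_comm, abs_mul, abs_of_nonneg (hp0 z _)]
      exact (mul_le_of_le_one_left (abs_nonneg _) (hp1 z _)).trans (hφD z e)
    -- The weighted gain at the profile `z` is a bounded function `ψ z` of the own action, type and
    -- signal, so the pull-out property applies to each `z`.
    let ψ : (∀ j, G.Y j) → G.Y i × E i × S.T i → ℝ := fun z x =>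
      {x : G.Y i × E i × S.T i | x.1 = b ∧ x.2.2 = t}.indicator (fun x => φ x.2.1 * D z x.2.1) x
    have hψ : ∀ z, Measurable (ψ z) := fun z => by
      refine Measurable.indicator ((hφ.comp (by fun_prop)).mul ((hD z).comp (by fun_prop))) ?_
      exact (measurable_fst (measurableSet_singleton b)).inter
        ((by fun_prop : Measurable fun x : G.Y i × E i × S.T i => x.2.2)
          (measurableSet_singleton t))
    have hψb : ∀ z x, |ψ z x| ≤ C + C := fun z x => by
      simp only [ψ, Set.indicator_apply]
      split_ifs
      · exact hφD z _
      · simpa using hC0 z x.2.1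
    have hint : ∀ z, Integrable (fun w : Outcome G S => ψ z (w.1 i, w.2.1 i, w.2.2 i)) ν := fun z =>
      Integrable.of_bound ((hψ z).comp hI).aestronglyMeasurable (C + C)
        (ae_of_all _ fun w => hψb z _)
    have hint' : ∀ z, Integrable (fun w : Outcome G S => ψ z (w.1 i, w.2.1 i, w.2.2 i) *
        p z (w.1 i, w.2.1 i, w.2.2 i)) ν := fun z =>
      Integrable.of_bound (((hψ z).mul (hpm z)).comp hI).aestronglyMeasurable (C + C)
        (ae_of_all _ fun w => by
          rw [norm_mul, Real.norm_eq_abs, Real.norm_eq_abs, abs_of_nonneg (hp0 z _)]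
          exact (mul_le_of_le_one_right (abs_nonneg _) (hp1 z _)).trans (hψb z _))
    rw [← integral_indicator hB, ← integral_indicator hB]
    calc _ = ∫ w, ∑ z, {w : Outcome G S | w.1 = z}.indicator
            (fun w => ψ z (w.1 i, w.2.1 i, w.2.2 i)) w ∂ν := by
          congr 1
          ext w
          simp only [Set.indicator_apply, Set.mem_ofPred_eq, ψ, D]
          rw [Finset.sum_ite_eq]
          simp only [Finset.mem_univ, if_true]
          split_ifs with h
          · rw [← h.1, Function.update_eq_self]
          · rfl
      _ = ∑ z, ∫ w, ψ z (w.1 i, w.2.1 i, w.2.2 i) * p z (w.1 i, w.2.1 i, w.2.2 i) ∂ν := by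
          rw [integral_finsetSum _ fun z _ => (hint z).indicator (hz z)]
          refine Finset.sum_congr rfl fun z _ => ?_
          rw [integral_indicator (hz z)]
          exact setIntegral_comp_eq_integral_mul_condProb hI (hz z) (hp z) (hψ z) ⟨_, hψb z⟩
      _ = _ := by
          rw [← integral_finsetSum _ fun z _ => hint' z]
          congr 1
          ext w
          simp only [Set.indicator_apply, Set.mem_ofPred_eq, ψ]
          split_ifs with h
          · rw [Finset.mul_sum]
            refine Finset.sum_congr rfl fun z _ => ?_
            rw [h.1, h.2]
            ring
          · simp

/-- Incentive compatibility in terms of conditional expected payoffs is the integrated form. -/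
theorem incentive_iff_obedient (G : BasicGame N E) (S : InfoStructure N E)
    (ν : Measure (Outcome G S)) [IsProbabilityMeasure ν] :
    (∀ i : N, ∀ᵐ w ∂ν, ∀ a : G.Y i,
      condPayoff G S ν i a w ≤ condPayoff G S ν i (w.1 i) w) ↔ Obedient G.payoff ν := by
  have hB : ∀ i (b : G.Y i) (t : S.T i),
      MeasurableSet {w : Outcome G S | w.1 i = b ∧ w.2.2 i = t} := fun i b t =>
    MeasurableSet.inter
      ((by fun_prop : Measurable fun w : Outcome G S => w.1 i) (measurableSet_singleton b))
      ((by fun_prop : Measurable fun w : Outcome G S => w.2.2 i) (measurableSet_singleton t))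
  constructor
  · intro h i a b t φ hφ hφ0 _ hC
    obtain ⟨d, hd, hd1, hd2⟩ := exists_condPayoff_sub_eq G S ν i a b t
    rw [(hd2 φ hφ hφ0 hC).2]
    refine setIntegral_nonpos_ae (hB i b t) ?_
    filter_upwards [hd1, h i] with w h1 h2 hw
    rw [← h1 hw]
    have h3 := h2 a
    rw [hw.1] at h3
    exact mul_nonpos_of_nonneg_of_nonpos (hφ0 _) (sub_nonpos.2 h3)
  · intro h i
    have key : ∀ a b t, ∀ᵐ w ∂ν, w.1 i = b ∧ w.2.2 i = t →
        condPayoff G S ν i a w ≤ condPayoff G S ν i b w := by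
      intro a b t
      obtain ⟨d, hd, hd1, hd2⟩ := exists_condPayoff_sub_eq G S ν i a b t
      -- The test functions are the indicators of the types at which the deviation is profitable
      -- and payoffs are bounded by `n`.
      let B : ℕ → Set (E i) := fun n => {e | 0 < d e} ∩ {e | ∀ z, |G.payoff i z e| ≤ n}
      have hBm : ∀ n, MeasurableSet (B n) := fun n => by
        refine (measurableSet_lt measurable_const hd).inter ?_
        simp only [Set.ofPred_forall]
        refine MeasurableSet.iInter fun z => ?_
        exact measurableSet_le (G.measurable_payoff i z).abs measurable_const
      have hnull : ∀ n, ∀ᵐ w ∂ν, w.1 i = b ∧ w.2.2 i = t → w.2.1 i ∉ B n := fun n => by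
        have hφm : Measurable ((B n).indicator fun _ => (1 : ℝ)) :=
          measurable_const.indicator (hBm n)
        have hφ0 : ∀ e, 0 ≤ (B n).indicator (fun _ => (1 : ℝ)) e := fun e =>
          Set.indicator_nonneg (fun _ _ => zero_le_one) e
        have hb : ∃ C, ∀ z e, (B n).indicator (fun _ => (1 : ℝ)) e * |G.payoff i z e| ≤ C :=
          ⟨n, fun z e => by
            by_cases he : e ∈ B n
            · simpa [he] using he.2 z
            · simp [he]⟩
        have h1 := h i a b t _ hφm hφ0
          ⟨1, fun e => Set.indicator_le_self' (fun _ _ => zero_le_one) e⟩ hb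
        obtain ⟨⟨C, hC⟩, h2⟩ := hd2 _ hφm hφ0 hb
        rw [h2] at h1
        have hnn : ∀ w : Outcome G S,
            0 ≤ (B n).indicator (fun _ => (1 : ℝ)) (w.2.1 i) * d (w.2.1 i) := fun w => by
          by_cases he : w.2.1 i ∈ B n
          · simpa [he] using he.1.le
          · simp [he]
        have hint : Integrable (fun w : Outcome G S =>
            (B n).indicator (fun _ => (1 : ℝ)) (w.2.1 i) * d (w.2.1 i)) ν :=
          Integrable.of_bound ((hφm.mul hd).comp
            (by fun_prop : Measurable fun w : Outcome G S => w.2.1 i)).aestronglyMeasurable C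
            (ae_of_all _ fun w => hC _)
        have h3 := (setIntegral_eq_zero_iff_of_nonneg_ae (ae_of_all _ hnn) hint.integrableOn).1
          (le_antisymm h1 (integral_nonneg hnn))
        rw [Filter.EventuallyEq, ae_restrict_iff' (hB i b t)] at h3
        filter_upwards [h3] with w hw hbt hmem
        have := hw hbt
        simp only [hmem, Set.indicator_of_mem, one_mul, Pi.zero_apply] at this
        exact hmem.1.ne' this
      filter_upwards [hd1, ae_all_iff.2 hnull] with w h1 h2 hbt
      rw [← sub_nonpos, h1 hbt]
      by_contra! hpos
      obtain ⟨n, hn⟩ := exists_nat_ge (∑ z, |G.payoff i z (w.2.1 i)|)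
      exact h2 n hbt ⟨hpos, fun z => (Finset.single_le_sum
        (f := fun z => |G.payoff i z (w.2.1 i)|) (fun _ _ => abs_nonneg _)
        (Finset.mem_univ z)).trans hn⟩
    filter_upwards [ae_all_iff.2 fun a => ae_all_iff.2 fun b => ae_all_iff.2 fun t => key a b t]
      with w hw a
    exact hw a _ _ ⟨rfl, rfl⟩

end Obedience

/-! ### Games with actions in any universe -/

section Transport

variable {N : Type*} [Fintype N] [DecidableEq N] {E : N → Type*} [∀ i, MeasurableSpace (E i)]

/-- The renaming of actions, as a measurable equivalence of outcomes. -/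
def outcomeEquiv (E : N → Type*) [∀ i, MeasurableSpace (E i)] {A A' : N → Type*}
    [∀ i, MeasurableSpace (A i)] [∀ i, MeasurableSpace (A' i)] (e : ∀ i, A i ≃ᵐ A' i)
    (T : N → Type*) [∀ i, MeasurableSpace (T i)] :
    ((∀ i, A i) × (∀ i, E i) × (∀ i, T i)) ≃ᵐ ((∀ i, A' i) × (∀ i, E i) × (∀ i, T i)) :=
  (MeasurableEquiv.piCongrRight e).prodCongr (MeasurableEquiv.refl _)

theorem Obedient.map_outcomeEquiv {A A' T : N → Type*} [∀ i, MeasurableSpace (A i)]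
    [∀ i, MeasurableSpace (A' i)] [∀ i, MeasurableSpace (T i)] {pay : ∀ i, (∀ j, A j) → E i → ℝ}
    {ν : Measure ((∀ i, A i) × (∀ i, E i) × (∀ i, T i))} (h : Obedient pay ν)
    (e : ∀ i, A i ≃ᵐ A' i) :
    Obedient (fun i y => pay i fun j => (e j).symm (y j)) (ν.map (outcomeEquiv E e T)) := by
  rintro i a b t φ hφ hφ0 hφb ⟨C, hC⟩
  have h1 := h i ((e i).symm a) ((e i).symm b) t φ hφ hφ0 hφb ⟨C, fun z x => by
    simpa using hC (fun j => e j (z j)) x⟩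
  rw [setIntegral_map_equiv]
  convert h1 using 2
  · congr 1
    ext w
    change (e i (w.1 i) = b ∧ w.2.2 i = t) ↔ _
    simp [← MeasurableEquiv.eq_symm_apply]
  · ext w
    change φ (w.2.1 i) * (pay i (fun j => (e j).symm
        (Function.update (fun k => e k (w.1 k)) i a j)) (w.2.1 i) -
        pay i (fun j => (e j).symm (e j (w.1 j))) (w.2.1 i)) = _
    have h2 : (fun j => (e j).symm (Function.update (fun k => e k (w.1 k)) i a j)) =
        Function.update w.1 i ((e i).symm a) := by
      ext j
      by_cases hj : j = i
      · subst hj; simp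
      · simp [hj]
    rw [h2]
    simp

/-- The inclusion of predictions for the games whose actions lie in `Type` gives every obedient law
under `S₁`, with actions in any universe, an obedient counterpart under `S₂`. -/
theorem exists_obedient_of_bcePredictions_subset {F : Measure (∀ i, E i)} [IsProbabilityMeasure F]
    {S₁ S₂ : InfoStructure N E}
    (H : ∀ G : BasicGame N E, bcePredictions F G S₁ ⊆ bcePredictions F G S₂)
    {A : N → Type*} [∀ i, Finite (A i)] [∀ i, MeasurableSpace (A i)]
    [∀ i, DiscreteMeasurableSpace (A i)] (pay : ∀ i, (∀ j, A j) → E i → ℝ)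
    (hpay : ∀ i y, Measurable (pay i y))
    (ν : Measure ((∀ i, A i) × (∀ i, E i) × (∀ i, S₁.T i))) [IsProbabilityMeasure ν]
    (hcons : ν.map Prod.snd = F ⊗ₘ S₁.law) (hob : Obedient pay ν) :
    ∃ ν' : Measure ((∀ i, A i) × (∀ i, E i) × (∀ i, S₂.T i)), IsProbabilityMeasure ν' ∧
      ν'.map Prod.snd = F ⊗ₘ S₂.law ∧ Obedient pay ν' ∧ ν'.map Prod.fst = ν.map Prod.fst := by
  let e : ∀ i, A i ≃ᵐ Fin (Nat.card (A i)) := fun i =>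
    { toEquiv := Finite.equivFin (A i)
      measurable_toFun := measurable_of_countable _
      measurable_invFun := measurable_of_countable _ }
  -- `BasicGame` has its actions in `Type`, so they are renamed to elements of `Fin`.
  let G : BasicGame N E :=
    { Y := fun i => Fin (Nat.card (A i))
      fintypeY := fun i => inferInstance
      measY := fun i => inferInstance
      discreteY := fun i => inferInstance
      payoff := fun i y => pay i fun j => (e j).symm (y j)
      measurable_payoff := fun i y => hpay i _ }
  let ν₁ : Measure (Outcome G S₁) := ν.map (outcomeEquiv E e S₁.T)
  have hν₁ : IsProbabilityMeasure ν₁ :=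
    Measure.isProbabilityMeasure_map (outcomeEquiv E e S₁.T).measurable.aemeasurable
  have hbce : IsBCE F G S₁ ν₁ :=
    { prob := hν₁
      consistent := by
        rw [← hcons, Measure.map_map measurable_snd (outcomeEquiv E e S₁.T).measurable]
        rfl
      incentive := (incentive_iff_obedient G S₁ ν₁).2 (hob.map_outcomeEquiv e) }
  have hmem : (fun y => ν₁.real {w | w.1 = y}) ∈ bcePredictions F G S₁ := by
    refine ⟨⟨fun y => measureReal_nonneg, ?_⟩, ν₁, hbce, fun y => rfl⟩
    have hp : IsProbabilityMeasure (ν₁.map Prod.fst) :=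
      Measure.isProbabilityMeasure_map measurable_fst.aemeasurable
    have h1 : ∀ y, ν₁.real {w | w.1 = y} = (ν₁.map Prod.fst).real {y} := fun y => by
      rw [map_measureReal_apply measurable_fst (measurableSet_singleton y)]
      rfl
    simp only [h1]
    rw [sum_measureReal_singleton]
    simp
  obtain ⟨-, ν₂, hν₂, hq⟩ := H G hmem
  have := hν₂.prob
  have hsymm := ((incentive_iff_obedient G S₂ ν₂).1 hν₂.incentive).map_outcomeEquiv
    (A' := A) (fun i => (e i).symm)
  have hmeas := (outcomeEquiv E (fun i => (e i).symm) S₂.T).measurable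
  refine ⟨ν₂.map (outcomeEquiv E (fun i => (e i).symm) S₂.T),
    Measure.isProbabilityMeasure_map hmeas.aemeasurable, ?_, ?_, ?_⟩
  · rw [← hν₂.consistent, Measure.map_map measurable_snd hmeas]
    rfl
  · convert hsymm using 3
    simp [G]
  · have h1 : ν₂.map Prod.fst = ν₁.map Prod.fst := by
      have hp1 : IsProbabilityMeasure (ν₁.map Prod.fst) :=
        Measure.isProbabilityMeasure_map measurable_fst.aemeasurable
      have hp2 : IsProbabilityMeasure (ν₂.map Prod.fst) :=
        Measure.isProbabilityMeasure_map measurable_fst.aemeasurable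
      refine Measure.ext_of_singleton fun y => ?_
      rw [← measureReal_eq_measureReal_iff, map_measureReal_apply measurable_fst
        (measurableSet_singleton y), map_measureReal_apply measurable_fst
        (measurableSet_singleton y)]
      exact (hq y).symm
    let E' := MeasurableEquiv.piCongrRight fun i => (e i).symm
    have h2 : (ν₂.map (outcomeEquiv E (fun i => (e i).symm) S₂.T)).map Prod.fst =
        (ν₂.map Prod.fst).map E' := by
      rw [Measure.map_map measurable_fst hmeas, Measure.map_map E'.measurable measurable_fst]
      rfl
    rw [h2, h1, Measure.map_map measurable_fst (outcomeEquiv E e S₁.T).measurable,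
      Measure.map_map E'.measurable (measurable_fst.comp (outcomeEquiv E e S₁.T).measurable)]
    congr 1
    ext w j
    exact (e j).symm_apply_apply (w.1 j)

end Transport

/-! ### Marginals of combinations -/

section Combination

variable {N : Type*} [Fintype N] [DecidableEq N]

theorem sum_measure_zip_right {T₁ T₂ : N → Type*} [∀ i, MeasurableSpace (T₁ i)]
    [∀ i, MeasurableSpace (T₂ i)] [∀ i, Fintype (T₁ i)] [∀ i, Fintype (T₂ i)]
    [∀ i, DiscreteMeasurableSpace (T₁ i)] [∀ i, DiscreteMeasurableSpace (T₂ i)]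
    (μ : Measure (∀ i, T₁ i × T₂ i)) (t₁ : ∀ i, T₁ i) :
    ∑ t₂ : (∀ i, T₂ i), μ {fun i => (t₁ i, t₂ i)} = μ.map (fun p j => (p j).1) {t₁} := by
  rw [Measure.map_apply (by fun_prop) (measurableSet_singleton t₁),
    ← tsum_fintype (L := .unconditional _),
    ← measure_iUnion _ fun _ => measurableSet_singleton _]
  · congr 1
    ext p
    simp only [Set.mem_iUnion, Set.mem_singleton_iff, Set.mem_preimage]
    constructor
    · rintro ⟨t₂, rfl⟩
      rfl
    · rintro rfl
      exact ⟨fun i => (p i).2, rfl⟩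
  · intro t t' h
    simp only [Function.onFun, Set.disjoint_singleton]
    exact fun heq => h (funext fun i => congrArg Prod.snd (congrFun heq i))

theorem sum_measure_zip_left {T₁ T₂ : N → Type*} [∀ i, MeasurableSpace (T₁ i)]
    [∀ i, MeasurableSpace (T₂ i)] [∀ i, Fintype (T₁ i)] [∀ i, Fintype (T₂ i)]
    [∀ i, DiscreteMeasurableSpace (T₁ i)] [∀ i, DiscreteMeasurableSpace (T₂ i)]
    (μ : Measure (∀ i, T₁ i × T₂ i)) (t₂ : ∀ i, T₂ i) :
    ∑ t₁ : (∀ i, T₁ i), μ {fun i => (t₁ i, t₂ i)} = μ.map (fun p j => (p j).2) {t₂} := by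
  rw [Measure.map_apply (by fun_prop) (measurableSet_singleton t₂),
    ← tsum_fintype (L := .unconditional _),
    ← measure_iUnion _ fun _ => measurableSet_singleton _]
  · congr 1
    ext p
    simp only [Set.mem_iUnion, Set.mem_singleton_iff, Set.mem_preimage]
    constructor
    · rintro ⟨t₁, rfl⟩
      rfl
    · rintro rfl
      exact ⟨fun i => (p i).1, rfl⟩
  · intro t t' h
    simp only [Function.onFun, Set.disjoint_singleton]
    exact fun heq => h (funext fun i => congrArg Prod.fst (congrFun heq i))

variable {E : N → Type*} [∀ i, MeasurableSpace (E i)] {S₁ S₂ : InfoStructure N E}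
  {K : Kernel (∀ i, E i) (∀ i, S₁.T i × S₂.T i)}

theorem IsCombination.map_fst (hK : IsCombination S₁ S₂ K)
    (F : Measure (∀ i, E i)) [IsProbabilityMeasure F] :
    (F ⊗ₘ K).map (fun w => (w.1, fun j => (w.2 j).1)) = F ⊗ₘ S₁.law := by
  have := hK.markov
  have hf : Measurable fun (p : ∀ i, S₁.T i × S₂.T i) j => (p j).1 := by fun_prop
  have h : K.map (fun p j => (p j).1) = S₁.law := by
    ext ε : 1
    refine Measure.ext_of_singleton fun t => ?_
    rw [Kernel.map_apply _ hf, ← hK.sum_right ε t, sum_measure_zip_right]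
  rw [← h, Measure.compProd_map hf]
  rfl

theorem IsCombination.map_snd (hK : IsCombination S₁ S₂ K)
    (F : Measure (∀ i, E i)) [IsProbabilityMeasure F] :
    (F ⊗ₘ K).map (fun w => (w.1, fun j => (w.2 j).2)) = F ⊗ₘ S₂.law := by
  have := hK.markov
  have hf : Measurable fun (p : ∀ i, S₁.T i × S₂.T i) j => (p j).2 := by fun_prop
  have h : K.map (fun p j => (p j).2) = S₂.law := by
    ext ε : 1
    refine Measure.ext_of_singleton fun t => ?_
    rw [Kernel.map_apply _ hf, ← hK.sum_left ε t, sum_measure_zip_left]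
  rw [← h, Measure.compProd_map hf]
  rfl

end Combination

/-! ### Individual sufficiency and the inclusion of predictions -/

section Sufficiency

variable {N : Type*} [Fintype N] [DecidableEq N] {E : N → Type*} [∀ i, MeasurableSpace (E i)]
  {F : Measure (∀ i, E i)} [IsProbabilityMeasure F] {S₁ S₂ : InfoStructure N E}

/-- The conditional probability given `τ¹ᵢ` is also the one given the intermediate `(τ¹ᵢ, εᵢ)`. -/
theorem IndividuallySufficient.ownType (h : IndividuallySufficient F S₁ S₂) :
    IndividuallySufficientOwnType F S₁ S₂ := by
  obtain ⟨K, hK, h⟩ := h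
  refine ⟨K, hK, fun i A => ?_⟩
  have := hK.markov
  have hs : MeasurableSet {w : (∀ j, E j) × (∀ j, S₁.T j × S₂.T j) | (w.2 i).2 ∈ A} :=
    (by fun_prop : Measurable fun w : (∀ j, E j) × (∀ j, S₁.T j × S₂.T j) => (w.2 i).2)
      (MeasurableSet.of_discrete (s := A))
  have hI : Measurable fun w : (∀ j, E j) × (∀ j, S₁.T j × S₂.T j) => (w.2 i).1 := by fun_prop
  obtain ⟨q, hq, -, -, hqe⟩ := exists_measurable_comp_eq_condProb (μ := F ⊗ₘ K) hI hs
  have h1 := (h i A).trans hqe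
  refine h1.trans (condProb_comp_ae_eq (g := fun x => q x.1)
    (I := fun w : (∀ j, E j) × (∀ j, S₁.T j × S₂.T j) =>
      ((fun j => (w.2 j).1 : ∀ j, S₁.T j), w.1))
    (J := fun w => ((w.2 i).1, w.1 i)) (by fun_prop) ?_ (by fun_prop) h1).symm
  rw [← measurable_iff_comap_le]
  exact Measurable.comp (g := fun x : (∀ j, S₁.T j) × (∀ j, E j) => (x.1 i, x.2 i))
    (by fun_prop) (comap_measurable _)

/-- If `εᵢ = g (τ¹ᵢ)` almost surely, then a function of `(τ¹ᵢ, εᵢ)` is a function of `τ¹ᵢ`. -/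
theorem IndividuallySufficientOwnType.of_revealsOwnType (hr : RevealsOwnType F S₁)
    (h : IndividuallySufficientOwnType F S₁ S₂) : IndividuallySufficient F S₁ S₂ := by
  obtain ⟨K, hK, h⟩ := h
  refine ⟨K, hK, fun i A => ?_⟩
  have := hK.markov
  have hs : MeasurableSet {w : (∀ j, E j) × (∀ j, S₁.T j × S₂.T j) | (w.2 i).2 ∈ A} :=
    (by fun_prop : Measurable fun w : (∀ j, E j) × (∀ j, S₁.T j × S₂.T j) => (w.2 i).2)
      (MeasurableSet.of_discrete (s := A))
  have hI : Measurable fun w : (∀ j, E j) × (∀ j, S₁.T j × S₂.T j) => ((w.2 i).1, w.1 i) := by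
    fun_prop
  obtain ⟨q, hq, -, -, hqe⟩ := exists_measurable_comp_eq_condProb (μ := F ⊗ₘ K) hI hs
  obtain ⟨g, hg⟩ := hr i
  rw [← hK.map_fst F] at hg
  have hg' := ae_of_ae_map (by fun_prop) hg
  have h1 := (h i A).trans hqe
  have h2 : ∀ᵐ w ∂(F ⊗ₘ K), q ((w.2 i).1, w.1 i) = q ((w.2 i).1, g (w.2 i).1) := by
    filter_upwards [hg'] with w hw
    rw [hw]
  have h3 := h1.trans h2
  refine h3.trans (condProb_comp_ae_eq (g := fun t => q (t, g t))
    (I := fun w : (∀ j, E j) × (∀ j, S₁.T j × S₂.T j) =>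
      ((fun j => (w.2 j).1 : ∀ j, S₁.T j), w.1))
    (J := fun w => (w.2 i).1) (by fun_prop) ?_ (measurable_of_countable _) h3).symm
  rw [← measurable_iff_comap_le]
  exact Measurable.comp (g := fun x : (∀ j, S₁.T j) × (∀ j, E j) => x.1 i)
    (by fun_prop) (comap_measurable _)

/-- A BCE under `S₁` becomes a BCE under `S₂` with the same prediction when the signals of `S₂` are
drawn from the combination, independently of the actions given the types and signals of `S₁`. -/
theorem bcePredictions_subset_of_ownType (h : IndividuallySufficientOwnType F S₁ S₂)
    (G : BasicGame N E) : bcePredictions F G S₁ ⊆ bcePredictions F G S₂ := by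
  classical
  rintro q ⟨hq, ν, hν, hqν⟩
  obtain ⟨K, hK, hcond⟩ := h
  have := hK.markov
  have := hν.prob
  have hob := (incentive_iff_obedient G S₁ ν).1 hν.incentive
  have hT : Nonempty (∀ i, S₂.T i) := by
    obtain ⟨w⟩ := (F ⊗ₘ S₂.law).nonempty_of_neZero
    exact ⟨w.2⟩
  have hY : Nonempty (∀ i, G.Y i) := by
    obtain ⟨w⟩ := ν.nonempty_of_neZero
    exact ⟨w.1⟩
  set lam := F ⊗ₘ K
  let X : (∀ j, E j) × (∀ j, S₁.T j × S₂.T j) → (∀ j, S₁.T j) × (∀ j, E j) :=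
    fun w => (fun j => (w.2 j).1, w.1)
  let τ₂ : (∀ j, E j) × (∀ j, S₁.T j × S₂.T j) → ∀ j, S₂.T j := fun w j => (w.2 j).2
  have hX : Measurable X := by fun_prop
  have hτ₂ : Measurable τ₂ := by fun_prop
  let V : Outcome G S₁ → (∀ j, S₁.T j) × (∀ j, E j) := fun w => (w.2.2, w.2.1)
  have hV : Measurable V := by fun_prop
  let κ₂ := condDistrib τ₂ X lam
  let κ := condDistrib Prod.fst V ν
  have hmap : lam.map X = ν.map V := by
    have h1 : lam.map X = (F ⊗ₘ S₁.law).map Prod.swap := by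
      rw [← hK.map_fst F, Measure.map_map measurable_swap (by fun_prop)]
      rfl
    rw [h1, ← hν.consistent, Measure.map_map measurable_swap measurable_snd]
    rfl
  -- The actions and the signals of `S₂` are drawn independently given the types and the signals
  -- of `S₁`.
  let π := (lam.map X) ⊗ₘ (κ ×ₖ κ₂)
  have hlamX : IsProbabilityMeasure (lam.map X) := Measure.isProbabilityMeasure_map hX.aemeasurable
  have hπ₁ : π.map (Prod.map id Prod.fst) = ν.map fun w => (V w, w.1) := by
    rw [← Measure.compProd_map measurable_fst, ← Kernel.fst_eq, Kernel.fst_prod, hmap]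
    exact compProd_map_condDistrib measurable_fst.aemeasurable
  have hπ₂ : π.map (Prod.map id Prod.snd) = lam.map fun w => (X w, τ₂ w) := by
    rw [← Measure.compProd_map measurable_snd, ← Kernel.snd_eq, Kernel.snd_prod]
    exact compProd_map_condDistrib hτ₂.aemeasurable
  let out : ((∀ j, S₁.T j) × (∀ j, E j)) × ((∀ j, G.Y j) × (∀ j, S₂.T j)) → Outcome G S₂ :=
    fun x => (x.2.1, x.1.2, x.2.2)
  have hout : Measurable out := by fun_prop
  have hprob : IsProbabilityMeasure (π.map out) :=
    Measure.isProbabilityMeasure_map hout.aemeasurable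
  refine ⟨hq, π.map out, ⟨hprob, ?_, (incentive_iff_obedient G S₂ _).2 ?_⟩, fun y => ?_⟩
  · have h1 : (π.map out).map Prod.snd =
        (π.map (Prod.map id Prod.snd)).map fun x => (x.1.2, x.2) := by
      rw [Measure.map_map measurable_snd hout, Measure.map_map (by fun_prop) (by fun_prop)]
      rfl
    rw [h1, hπ₂, Measure.map_map (by fun_prop) (by fun_prop), ← hK.map_snd F]
    rfl
  · rintro i a b t φ hφ hφ0 ⟨C₀, hC₀⟩ ⟨C, hC⟩
    have hI : Measurable fun w : (∀ j, E j) × (∀ j, S₁.T j × S₂.T j) => ((w.2 i).1, w.1 i) := by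
      fun_prop
    have hs : MeasurableSet {p : ∀ j, S₂.T j | p i = t} :=
      (measurable_pi_apply i) (measurableSet_singleton t)
    have hs' : MeasurableSet
        {w : (∀ j, E j) × (∀ j, S₁.T j × S₂.T j) | (w.2 i).2 ∈ ({t} : Set (S₂.T i))} := hτ₂ hs
    obtain ⟨g, hg, hg0, hg1, hge⟩ := exists_measurable_comp_eq_condProb (μ := lam) hI hs'
    have hκ₂ : ∀ᵐ x ∂(lam.map X), (κ₂ x).real {p : ∀ j, S₂.T j | p i = t} = g (x.1 i, x.2 i) := by
      have hm : MeasurableSet {x : (∀ j, S₁.T j) × (∀ j, E j) |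
          (κ₂ x).real {p : ∀ j, S₂.T j | p i = t} = g (x.1 i, x.2 i)} :=
        measurableSet_eq_fun (Kernel.measurable_coe κ₂ hs).ennreal_toReal (by fun_prop)
      rw [ae_map_iff hX.aemeasurable hm]
      exact (condDistrib_ae_eq_condExp hX hτ₂ hs).trans ((hcond i {t}).trans hge)
    let Δ : (∀ j, G.Y j) → E i → ℝ := fun y e =>
      φ e * (G.payoff i (Function.update y i a) e - G.payoff i y e)
    have hΔ : Measurable fun x : (∀ j, G.Y j) × E i => Δ x.1 x.2 := by
      refine measurable_from_prod_countable_right fun y => ?_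
      exact hφ.mul ((G.measurable_payoff i (Function.update y i a)).sub (G.measurable_payoff i y))
    have hΔb : ∀ y e, |Δ y e| ≤ C + C := fun y e => by
      simp only [Δ]
      rw [abs_mul, abs_of_nonneg (hφ0 e)]
      refine (mul_le_mul_of_nonneg_left (abs_sub _ _) (hφ0 e)).trans ?_
      rw [mul_add]
      exact add_le_add (hC _ _) (hC _ _)
    -- The obedience integrand factors into a part `h` without `S₂`-signals and the indicator `u` of
    -- the signal `t`; the latter integrates to the weight `g`.
    let h : ((∀ j, S₁.T j) × (∀ j, E j)) × (∀ j, G.Y j) → ℝ := fun x =>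
      {y : ∀ j, G.Y j | y i = b}.indicator (fun y => Δ y (x.1.2 i)) x.2
    have hh : Measurable h := by
      have : h = {x : ((∀ j, S₁.T j) × (∀ j, E j)) × (∀ j, G.Y j) | x.2 i = b}.indicator
          fun x => Δ x.2 (x.1.2 i) := rfl
      rw [this]
      exact (hΔ.comp (by fun_prop : Measurable fun x : ((∀ j, S₁.T j) × (∀ j, E j)) ×
        (∀ j, G.Y j) => (x.2, x.1.2 i))).indicator
        ((by fun_prop : Measurable fun x : ((∀ j, S₁.T j) × (∀ j, E j)) × (∀ j, G.Y j) => x.2 i)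
          (measurableSet_singleton b))
    have hhb : ∀ x, ‖h x‖ ≤ C + C := fun x => by
      rw [Real.norm_eq_abs]
      by_cases hx : x.2 i = b
      · simpa [h, Set.indicator, hx] using hΔb x.2 (x.1.2 i)
      · simpa [h, Set.indicator, hx] using (abs_nonneg _).trans (hΔb x.2 (x.1.2 i))
    let u : (∀ j, S₂.T j) → ℝ := {p : ∀ j, S₂.T j | p i = t}.indicator fun _ => 1
    have hu : Measurable u := measurable_of_countable _
    have hub : ∀ p, ‖u p‖ ≤ 1 := fun p => by
      simp only [u, Set.indicator_apply]
      split_ifs <;> simp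
    have hset : MeasurableSet {w : Outcome G S₂ | w.1 i = b ∧ w.2.2 i = t} :=
      MeasurableSet.inter
        ((by fun_prop : Measurable fun w : Outcome G S₂ => w.1 i) (measurableSet_singleton b))
        ((by fun_prop : Measurable fun w : Outcome G S₂ => w.2.2 i) (measurableSet_singleton t))
    have hset₁ : ∀ t₁, MeasurableSet {w : Outcome G S₁ | w.1 i = b ∧ w.2.2 i = t₁} := fun t₁ =>
      MeasurableSet.inter
        ((by fun_prop : Measurable fun w : Outcome G S₁ => w.1 i) (measurableSet_singleton b))
        ((by fun_prop : Measurable fun w : Outcome G S₁ => w.2.2 i) (measurableSet_singleton t₁))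
    have hint : Integrable (fun x => h (x.1, x.2.1) * u x.2.2) π := by
      refine Integrable.of_bound (((hh.comp (by fun_prop)).mul
        (hu.comp (by fun_prop))).aestronglyMeasurable) ((C + C) * 1) (ae_of_all _ fun x => ?_)
      rw [norm_mul]
      exact mul_le_mul (hhb _) (hub _) (norm_nonneg _) ((norm_nonneg _).trans (hhb (x.1, x.2.1)))
    have hint₂ : Integrable (fun x => h x * g (x.1.1 i, x.1.2 i)) ((lam.map X) ⊗ₘ κ) := by
      refine Integrable.of_bound ((hh.mul (hg.comp (by fun_prop))).aestronglyMeasurable)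
        ((C + C) * 1) (ae_of_all _ fun x => ?_)
      rw [norm_mul, Real.norm_of_nonneg (hg0 _)]
      exact mul_le_mul (hhb _) (hg1 _) (hg0 _) ((norm_nonneg _).trans (hhb x))
    -- Split according to the `S₁`-signal: `r t₁` is an obedience integrand under `S₁` for the test
    -- function `φ * g (t₁, ·)`.
    let r : S₁.T i → Outcome G S₁ → ℝ := fun t₁ =>
      {w : Outcome G S₁ | w.1 i = b ∧ w.2.2 i = t₁}.indicator fun w =>
        (φ (w.2.1 i) * g (t₁, w.2.1 i)) * (G.payoff i (Function.update w.1 i a) (w.2.1 i) -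
          G.payoff i w.1 (w.2.1 i))
    have hr : ∀ t₁, Integrable (r t₁) ν := fun t₁ => by
      refine Integrable.of_bound (Measurable.indicator ?_ (hset₁ t₁)).aestronglyMeasurable
        (C + C) (ae_of_all _ fun w => ?_)
      · have hm : Measurable fun w : Outcome G S₁ => Δ w.1 (w.2.1 i) * g (t₁, w.2.1 i) :=
          (hΔ.comp (by fun_prop : Measurable fun w : Outcome G S₁ => (w.1, w.2.1 i))).mul
            (hg.comp (by fun_prop))
        convert hm using 2 with w
        simp only [Δ]
        ring
      · rw [Real.norm_eq_abs]
        simp only [r, Set.indicator_apply]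
        split_ifs
        · rw [mul_right_comm, abs_mul, abs_of_nonneg (hg0 _)]
          exact (mul_le_of_le_one_right (abs_nonneg _) (hg1 _)).trans (hΔb w.1 (w.2.1 i))
        · simpa using (abs_nonneg _).trans (hΔb w.1 (w.2.1 i))
    calc ∫ w in {w : Outcome G S₂ | w.1 i = b ∧ w.2.2 i = t}, Δ w.1 (w.2.1 i) ∂(π.map out)
        = ∫ x, h (x.1, x.2.1) * u x.2.2 ∂π := by
          have hm : Measurable fun w : Outcome G S₂ => Δ w.1 (w.2.1 i) :=
            hΔ.comp (by fun_prop : Measurable fun w : Outcome G S₂ => (w.1, w.2.1 i))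
          rw [← integral_indicator hset, integral_map hout.aemeasurable
            (hm.indicator hset).aestronglyMeasurable]
          congr 1
          ext x
          simp only [h, u, out, Set.indicator_apply, Set.mem_ofPred_eq]
          by_cases h1 : x.2.1 i = b <;> by_cases h2 : x.2.2 i = t <;> simp [h1, h2]
      _ = ∫ x, (∫ y, h (x, y) ∂κ x) * (κ₂ x).real {p : ∀ j, S₂.T j | p i = t} ∂(lam.map X) := by
          rw [Measure.integral_compProd hint]
          congr 1
          ext x
          simp only [Kernel.prod_apply]
          rw [integral_prod_mul (fun y => h (x, y)) u, integral_indicator_const _ hs]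
          simp
      _ = ∫ x, (∫ y, h (x, y) ∂κ x) * g (x.1 i, x.2 i) ∂(lam.map X) := by
          refine integral_congr_ae ?_
          filter_upwards [hκ₂] with x hx
          rw [hx]
      _ = ∫ w, h (V w, w.1) * g (w.2.2 i, w.2.1 i) ∂ν := by
          have hm : Measurable fun x : ((∀ j, S₁.T j) × (∀ j, E j)) × (∀ j, G.Y j) =>
              h x * g (x.1.1 i, x.1.2 i) := hh.mul (hg.comp (by fun_prop))
          simp only [← integral_mul_const]
          rw [← Measure.integral_compProd hint₂, hmap, compProd_map_condDistrib
            measurable_fst.aemeasurable, integral_map (by fun_prop)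
            hm.aestronglyMeasurable]
      _ = ∑ t₁, ∫ w, r t₁ w ∂ν := by
          rw [← integral_finsetSum _ fun t₁ _ => hr t₁]
          congr 1
          ext w
          simp only [h, V, r, Δ, Set.indicator_apply, Set.mem_ofPred_eq]
          by_cases hb : w.1 i = b
          · simp only [hb, true_and, if_true, Finset.sum_ite_eq, Finset.mem_univ]
            ring
          · simp [hb]
      _ ≤ 0 := by
          refine Finset.sum_nonpos fun t₁ _ => ?_
          rw [integral_indicator (hset₁ t₁)]
          refine hob i a b t₁ (fun e => φ e * g (t₁, e)) (hφ.mul (hg.comp (by fun_prop)))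
            (fun e => mul_nonneg (hφ0 e) (hg0 _))
            ⟨C₀, fun e => (mul_le_of_le_one_right (hφ0 e) (hg1 _)).trans (hC₀ e)⟩
            ⟨C, fun z e => ?_⟩
          rw [mul_right_comm]
          exact (mul_le_of_le_one_right (mul_nonneg (hφ0 e) (abs_nonneg _)) (hg1 _)).trans (hC z e)
  · have h1 : (π.map out).map Prod.fst = ν.map Prod.fst := by
      have h2 : (π.map out).map Prod.fst = (π.map (Prod.map id Prod.fst)).map Prod.snd := by
        rw [Measure.map_map measurable_fst hout, Measure.map_map measurable_snd (by fun_prop)]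
        rfl
      rw [h2, hπ₁, Measure.map_map measurable_snd (by fun_prop)]
      rfl
    have h3 : (π.map out).real {w | w.1 = y} = ((π.map out).map Prod.fst).real {y} :=
      (map_measureReal_apply measurable_fst (measurableSet_singleton y)).symm
    rw [hqν y, h3, h1]
    exact (map_measureReal_apply measurable_fst (measurableSet_singleton y)).symm

end Sufficiency

/-! ### Contingent deviations -/

section Deviations

variable {N : Type*} [Finite N] [DecidableEq N] {E : N → Type*} [∀ i, MeasurableSpace (E i)]
  {A T : N → Type*} [∀ i, Finite (A i)] [∀ i, MeasurableSpace (A i)]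
  [∀ i, DiscreteMeasurableSpace (A i)] [∀ i, MeasurableSpace (T i)]
  [∀ i, DiscreteMeasurableSpace (T i)] {pay : ∀ i, (∀ j, A j) → E i → ℝ}
  {ν : Measure ((∀ i, A i) × (∀ i, E i) × (∀ i, T i))} [IsFiniteMeasure ν]

theorem integrable_deviation {i : N} (hpay : ∀ y, Measurable (pay i y))
    (hb : ∃ C, ∀ y e, |pay i y e| ≤ C) {φ : E i → ℝ} (hφ : Measurable φ)
    (hφb : ∃ C, ∀ e, |φ e| ≤ C) (dev : A i → A i) :
    Integrable (fun w : (∀ i, A i) × (∀ i, E i) × (∀ i, T i) => φ (w.2.1 i) *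
      (pay i (Function.update w.1 i (dev (w.1 i))) (w.2.1 i) - pay i w.1 (w.2.1 i))) ν := by
  obtain ⟨C, hC⟩ := hb
  obtain ⟨D, hD⟩ := hφb
  have hm : Measurable fun x : (∀ j, A j) × E i => φ x.2 *
      (pay i (Function.update x.1 i (dev (x.1 i))) x.2 - pay i x.1 x.2) := by
    refine measurable_from_prod_countable_right fun y => ?_
    exact hφ.mul ((hpay (Function.update y i (dev (y i)))).sub (hpay y))
  refine Integrable.of_bound (hm.comp (by fun_prop :
    Measurable fun w : (∀ i, A i) × (∀ i, E i) × (∀ i, T i) => (w.1, w.2.1 i))).aestronglyMeasurable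
    (D * (C + C)) (ae_of_all _ fun w => ?_)
  rw [norm_mul]
  exact mul_le_mul (hD _) ((abs_sub _ _).trans (add_le_add (hC _ _) (hC _ _))) (norm_nonneg _)
    ((abs_nonneg _).trans (hD (w.2.1 i)))

/-- Obedience against a contingent deviation `dev`, on the recommendations in `B`. -/
theorem Obedient.setIntegral_deviation_nonpos (h : Obedient pay ν) {i : N}
    (hpay : ∀ y, Measurable (pay i y)) (hb : ∃ C, ∀ y e, |pay i y e| ≤ C) {φ : E i → ℝ}
    (hφ : Measurable φ) (hφ0 : ∀ e, 0 ≤ φ e) (hφb : ∃ C, ∀ e, φ e ≤ C) (dev : A i → A i)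
    (B : Set (A i)) (t : T i) :
    ∫ w in {w | w.1 i ∈ B ∧ w.2.2 i = t}, φ (w.2.1 i) *
      (pay i (Function.update w.1 i (dev (w.1 i))) (w.2.1 i) - pay i w.1 (w.2.1 i)) ∂ν ≤ 0 := by
  classical
  have := Fintype.ofFinite (A i)
  obtain ⟨D, hD⟩ := hφb
  have hφb' : ∃ C, ∀ e, |φ e| ≤ C := ⟨D, fun e => by rw [abs_of_nonneg (hφ0 e)]; exact hD e⟩
  have hset : ∀ b : A i, MeasurableSet
      {w : (∀ i, A i) × (∀ i, E i) × (∀ i, T i) | w.1 i = b ∧ w.2.2 i = t} := fun b =>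
    MeasurableSet.inter
      ((by fun_prop : Measurable fun w : (∀ i, A i) × (∀ i, E i) × (∀ i, T i) => w.1 i)
        (measurableSet_singleton b))
      ((by fun_prop : Measurable fun w : (∀ i, A i) × (∀ i, E i) × (∀ i, T i) => w.2.2 i)
        (measurableSet_singleton t))
  have hunion : {w : (∀ i, A i) × (∀ i, E i) × (∀ i, T i) | w.1 i ∈ B ∧ w.2.2 i = t} =
      ⋃ b ∈ B.toFinite.toFinset, {w | w.1 i = b ∧ w.2.2 i = t} := by
    ext w
    simp
  rw [hunion, integral_biUnion_finset _ (fun b _ => hset b)]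
  · refine Finset.sum_nonpos fun b _ => ?_
    obtain ⟨C, hC⟩ := hb
    refine le_of_eq_of_le (setIntegral_congr_fun (hset b) fun w hw => ?_)
      (h i (dev b) b t φ hφ hφ0 ⟨D, hD⟩ ⟨D * C, fun z e => mul_le_mul (hD e) (hC z e)
        (abs_nonneg _) ((hφ0 e).trans (hD e))⟩)
    simp only [hw.1]
  · intro b _ b' _ hbb'
    refine Set.disjoint_left.2 fun w hw hw' => hbb' (hw.1.symm.trans hw'.1)
  · exact fun b _ => (integrable_deviation hpay hb hφ hφb' dev).integrableOn

end Deviations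

/-! ### The reporting game -/

section ReportGame

variable {N : Type*} [Fintype N] [DecidableEq N] {E : N → Type*} [∀ i, MeasurableSpace (E i)]

/-- A measurable rectangle in the space of type profiles. -/
abbrev Rect (E : N → Type*) [∀ i, MeasurableSpace (E i)] : Type _ :=
  ∀ j, {B : Set (E j) // MeasurableSet B}

/-- An action in the reporting game: the player reports which of the sides of the rectangles in `s`
contain the own payoff type, reports a signal, and may shift one of the forecasts that go with that
signal up or down. -/
structure Report (T : N → Type*) (s : Finset (Rect E)) (i : N) where
  /-- The rectangles whose `i`-th side contains the own payoff type. -/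
  cell : Set s
  /-- The reported signal. -/
  signal : T i
  /-- The forecast to be shifted, if any, and the direction of the shift. -/
  shift : Option ((s × ∀ j, T j) × Bool)

namespace Report

variable {T : N → Type*} {s : Finset (Rect E)}

instance (i : N) : MeasurableSpace (Report T s i) := ⊤

instance (i : N) : DiscreteMeasurableSpace (Report T s i) := ⟨fun _ => trivial⟩

instance [∀ i, Fintype (T i)] (i : N) : Finite (Report T s i) :=
  Finite.of_injective (fun r : Report T s i => (r.cell, r.signal, r.shift))
    fun r r' h => by
      cases r
      cases r'
      simpa using h

/-- The true cell report of a payoff type. -/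
def cellOf (s : Finset (Rect E)) (i : N) (e : E i) : Set s := {R | e ∈ (R.1 i).1}

theorem measurable_cellOf (i : N) : Measurable (cellOf s i) :=
  measurable_set_iff.2 fun R => measurable_mem.2 (R.1 i).2

/-- The truthful reports. -/
def truth (T : N → Type*) (s : Finset (Rect E)) (w : (∀ j, E j) × (∀ j, T j)) (i : N) :
    Report T s i :=
  ⟨cellOf s i (w.1 i), w.2 i, none⟩

theorem measurable_truth [∀ i, MeasurableSpace (T i)] [∀ i, DiscreteMeasurableSpace (T i)]
    [∀ i, Fintype (T i)] : Measurable (truth T s) := by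
  refine measurable_pi_iff.2 fun i => ?_
  exact Measurable.comp (g := fun x : Set s × T i => (⟨x.1, x.2, none⟩ : Report T s i))
    (measurable_of_countable _) (((measurable_cellOf i).comp (by fun_prop)).prodMk (by fun_prop))

/-- The event that the types and signals of the opponents of `i` lie in `R` and equal `t`. -/
def othersEvent (i : N) (R : Rect E) (t : ∀ j, T j) : Set ((∀ j, E j) × (∀ j, T j)) :=
  {w | ∀ j, j ≠ i → w.1 j ∈ (R j).1 ∧ w.2 j = t j}

theorem measurableSet_othersEvent [∀ i, MeasurableSpace (T i)]
    [∀ i, DiscreteMeasurableSpace (T i)] (i : N) (R : Rect E) (t : ∀ j, T j) :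
    MeasurableSet (othersEvent i R t) := by
  have h : othersEvent i R t = ⋂ j, ⋂ _ : j ≠ i,
      {w : (∀ j, E j) × (∀ j, T j) | w.1 j ∈ (R j).1 ∧ w.2 j = t j} := by
    ext w
    simp [othersEvent]
  rw [h]
  refine MeasurableSet.iInter fun j => MeasurableSet.iInter fun _ => MeasurableSet.inter ?_ ?_
  · exact (by fun_prop : Measurable fun w : (∀ j, E j) × (∀ j, T j) => w.1 j) (R j).2
  · exact (by fun_prop : Measurable fun w : (∀ j, E j) × (∀ j, T j) => w.2 j)
      (measurableSet_singleton (t j))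

/-- The indicator of the event that the opponents of `i` report the rectangle and the signals of
`k`. It does not involve the report of `i`. -/
noncomputable def othersReport (i : N) (k : s × ∀ j, T j) : (∀ j, Report T s j) → ℝ :=
  {y : ∀ j, Report T s j | ∀ j, j ≠ i → k.1 ∈ (y j).cell ∧ (y j).signal = k.2 j}.indicator
    fun _ => 1

theorem othersReport_update (i : N) (k : s × ∀ j, T j) (y : ∀ j, Report T s j)
    (a : Report T s i) : othersReport i k (Function.update y i a) = othersReport i k y := by
  unfold othersReport
  refine Set.indicator_eq_indicator (forall_congr' fun j => forall_congr' fun hj => ?_) rfl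
  rw [Function.update_of_ne hj]

theorem othersReport_truth (i : N) (k : s × ∀ j, T j) (w : (∀ j, E j) × (∀ j, T j)) :
    othersReport i k (truth T s w) = (othersEvent i k.1.1 k.2).indicator (fun _ => 1) w :=
  rfl

theorem othersReport_nonneg (i : N) (k : s × ∀ j, T j) (y : ∀ j, Report T s j) :
    0 ≤ othersReport i k y :=
  Set.indicator_nonneg (fun _ _ => zero_le_one) y

theorem othersReport_le_one (i : N) (k : s × ∀ j, T j) (y : ∀ j, Report T s j) :
    othersReport i k y ≤ 1 :=
  Set.indicator_le_self' (fun _ _ => zero_le_one) y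

open Classical in
/-- The amount by which the forecast `k` is shifted. -/
noncomputable def shiftBy (δ : ℝ) (d : Option ((s × ∀ j, T j) × Bool)) (k : s × ∀ j, T j) : ℝ :=
  if d = some (k, true) then δ else if d = some (k, false) then -δ else 0

theorem abs_shiftBy_le {δ : ℝ} (hδ : 0 ≤ δ) (d : Option ((s × ∀ j, T j) × Bool))
    (k : s × ∀ j, T j) : |shiftBy δ d k| ≤ δ := by
  unfold shiftBy
  split_ifs <;> simp [abs_of_nonneg hδ, hδ]

theorem shiftBy_none (δ : ℝ) (k : s × ∀ j, T j) : shiftBy δ none k = 0 := by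
  simp [shiftBy]

/-- The forecast of `othersReport i k` announced with the report `a`, for player `i` of type `e`. -/
noncomputable def forecast (q : ∀ i, Rect E → (∀ j, T j) → T i × E i → ℝ) (δ : ℝ) (i : N)
    (k : s × ∀ j, T j) (a : Report T s i) (e : E i) : ℝ :=
  q i k.1.1 k.2 (a.signal, e) + shiftBy δ a.shift k

open Classical in
/-- The payoff in the reporting game: a unit for the true cell report, and the quadratic scores of
the forecasts. -/
noncomputable def pay [∀ i, Fintype (T i)]
    (q : ∀ i, Rect E → (∀ j, T j) → T i × E i → ℝ) (δ : ℝ) (i : N) (y : ∀ j, Report T s j) (e : E i) : ℝ :=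
  (if (y i).cell = cellOf s i e then 1 else 0) +
    ∑ k, (2 * forecast q δ i k (y i) e * othersReport i k y - forecast q δ i k (y i) e ^ 2)

variable [∀ i, Fintype (T i)] [∀ i, MeasurableSpace (T i)] [∀ i, DiscreteMeasurableSpace (T i)]
  {q : ∀ i, Rect E → (∀ j, T j) → T i × E i → ℝ} {δ : ℝ}

theorem measurable_forecast (hq : ∀ i R t, Measurable (q i R t)) (i : N) (k : s × ∀ j, T j)
    (a : Report T s i) : Measurable (forecast q δ i k a) :=
  ((hq i k.1.1 k.2).comp (by fun_prop)).add_const _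

theorem abs_forecast_le (hδ : 0 ≤ δ) (hq0 : ∀ i R t x, 0 ≤ q i R t x)
    (hq1 : ∀ i R t x, q i R t x ≤ 1) (i : N) (k : s × ∀ j, T j) (a : Report T s i) (e : E i) :
    |forecast q δ i k a e| ≤ 1 + δ := by
  refine (abs_add_le _ _).trans (add_le_add ?_ (abs_shiftBy_le hδ _ _))
  rw [abs_of_nonneg (hq0 _ _ _ _)]
  exact hq1 _ _ _ _

theorem measurable_pay (hq : ∀ i R t, Measurable (q i R t)) (i : N) (y : ∀ j, Report T s j) :
    Measurable (pay q δ i y) := by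
  classical
  refine Measurable.add (Measurable.ite ?_ measurable_const measurable_const)
    (Finset.measurable_sum _ fun k _ => ?_)
  · have h := measurable_cellOf (s := s) i (measurableSet_singleton (y i).cell)
    convert h using 1
    ext e
    exact eq_comm
  · have := measurable_forecast (δ := δ) hq i k (y i)
    fun_prop

theorem exists_abs_pay_le (hδ : 0 ≤ δ) (hq0 : ∀ i R t x, 0 ≤ q i R t x)
    (hq1 : ∀ i R t x, q i R t x ≤ 1) (i : N) :
    ∃ C, ∀ (y : ∀ j, Report T s j) (e : E i), |pay q δ i y e| ≤ C := by
  refine ⟨1 + ∑ _k : s × ∀ j, T j, (2 * (1 + δ) + (1 + δ) ^ 2), fun y e => ?_⟩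
  refine (abs_add_le _ _).trans (add_le_add (by split_ifs <;> simp) ?_)
  refine (Finset.abs_sum_le_sum_abs _ _).trans (Finset.sum_le_sum fun k _ => ?_)
  have h := abs_forecast_le hδ hq0 hq1 i k (y i) e
  refine (abs_sub _ _).trans (add_le_add ?_ ?_)
  · rw [abs_mul, abs_mul, abs_of_nonneg (othersReport_nonneg i k y), abs_two]
    calc 2 * |forecast q δ i k (y i) e| * othersReport i k y
        ≤ 2 * |forecast q δ i k (y i) e| * 1 :=
          mul_le_mul_of_nonneg_left (othersReport_le_one i k y) (by positivity)
      _ ≤ _ := by linarith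
  · rw [abs_pow]
    exact pow_le_pow_left₀ (abs_nonneg _) h 2

/-- Truthful reports are obedient, as the quadratic score is proper and the forecasts that go with
the true signal are the conditional probabilities. -/
theorem obedient_truth (hδ : 0 ≤ δ) (J : Measure ((∀ j, E j) × (∀ j, T j)))
    [IsProbabilityMeasure J] (hq : ∀ i R t, Measurable (q i R t))
    (hq0 : ∀ i R t x, 0 ≤ q i R t x) (hq1 : ∀ i R t x, q i R t x ≤ 1)
    (hqJ : ∀ i R t, J⟦othersEvent i R t | MeasurableSpace.comap
      (fun w : (∀ j, E j) × (∀ j, T j) => (w.2 i, w.1 i)) inferInstance⟧ =ᵐ[J]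
        fun w => q i R t (w.2 i, w.1 i)) :
    Obedient (pay (s := s) q δ) (J.map fun w => (truth T s w, w.1, w.2)) := by
  classical
  rintro i a b t φ hφ hφ0 ⟨D, hD⟩ -
  have htruth := measurable_truth (E := E) (T := T) (s := s)
  have hI : Measurable fun w : (∀ j, E j) × (∀ j, T j) => (w.2 i, w.1 i) := by fun_prop
  let Z : Set (T i × E i) := {x | (⟨cellOf s i x.2, x.1, none⟩ : Report T s i) = b ∧ x.1 = t}
  have hZ : MeasurableSet Z := by
    have h : Measurable fun x : T i × E i => (⟨cellOf s i x.2, x.1, none⟩ : Report T s i) :=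
      Measurable.comp (g := fun x : Set s × T i => (⟨x.1, x.2, none⟩ : Report T s i))
        (measurable_of_countable _) (((measurable_cellOf i).comp (by fun_prop)).prodMk
          (by fun_prop))
    exact (h (measurableSet_singleton b)).inter (measurable_fst (measurableSet_singleton t))
  -- `r k` are the forecasts after the deviation to `a`, `p k` the truthful ones. The gain is `g`,
  -- from the cell report, plus `ψ k` on the opponents' event of `k` plus `c k`, for all `k`.
  let r : (s × ∀ j, T j) → E i → ℝ := fun k e => forecast q δ i k a e
  have hr : ∀ k, Measurable (r k) := fun k => measurable_forecast hq i k a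
  have hrb : ∀ k e, |r k e| ≤ 1 + δ := fun k e => abs_forecast_le hδ hq0 hq1 i k a e
  let p : (s × ∀ j, T j) → T i × E i → ℝ := fun k => q i k.1.1 k.2
  have hp : ∀ k, Measurable (p k) := fun k => hq i k.1.1 k.2
  let χ : T i × E i → ℝ := Z.indicator fun x => φ x.2
  have hχ : Measurable χ := (hφ.comp measurable_snd).indicator hZ
  have hχ0 : ∀ x, 0 ≤ χ x := fun x => Set.indicator_nonneg (fun _ _ => hφ0 _) x
  have hχD : ∀ x, χ x ≤ D := fun x =>
    (Set.indicator_le_self' (fun _ _ => hφ0 _) x).trans (hD x.2)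
  let g : T i × E i → ℝ := fun x => χ x * ((if a.cell = cellOf s i x.2 then 1 else 0) - 1)
  let ψ : (s × ∀ j, T j) → T i × E i → ℝ := fun k x => χ x * (2 * (r k x.2 - p k x))
  let c : (s × ∀ j, T j) → T i × E i → ℝ := fun k x => χ x * (p k x ^ 2 - r k x.2 ^ 2)
  have hD0 : ∀ x : T i × E i, 0 ≤ D := fun x => (hφ0 x.2).trans (hD x.2)
  have hbound : ∀ {u : T i × E i → ℝ} (C : ℝ), Measurable u → (∀ x, |u x| ≤ C) →
      Integrable (fun w : (∀ j, E j) × (∀ j, T j) => u (w.2 i, w.1 i)) J := fun C hu hC =>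
    Integrable.of_bound (hu.comp hI).aestronglyMeasurable C (ae_of_all _ fun w => hC _)
  have hpb : ∀ k x, |p k x| ≤ 1 := fun k x => by
    rw [abs_of_nonneg (hq0 _ _ _ _)]
    exact hq1 _ _ _ _
  have hχmul : ∀ {v C : ℝ} x, |v| ≤ C → |χ x * v| ≤ D * C := fun x hv => by
    rw [abs_mul, abs_of_nonneg (hχ0 x)]
    exact mul_le_mul (hχD x) hv (abs_nonneg _) (hD0 x)
  have hgm : Measurable g := by
    refine hχ.mul (Measurable.sub_const (Measurable.ite ?_ measurable_const measurable_const) _)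
    have h := ((measurable_cellOf (s := s) i).comp
      (measurable_snd : Measurable (Prod.snd : T i × E i → E i))) (measurableSet_singleton a.cell)
    convert h using 1
    ext e
    exact eq_comm
  have hgb : ∀ x, |g x| ≤ D * 1 := fun x => hχmul x (by split_ifs <;> simp)
  have hψm : ∀ k, Measurable (ψ k) := fun k => by
    have := hr k
    have := hp k
    fun_prop
  have hψb : ∀ k x, |ψ k x| ≤ D * (2 * ((1 + δ) + 1)) := fun k x => hχmul x (by
    rw [abs_mul, abs_two]
    exact mul_le_mul_of_nonneg_left
      ((abs_sub _ _).trans (add_le_add (hrb k x.2) (hpb k x))) zero_le_two)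
  have hcm : ∀ k, Measurable (c k) := fun k => by
    have := hr k
    have := hp k
    fun_prop
  have hcb : ∀ k x, |c k x| ≤ D * (1 ^ 2 + (1 + δ) ^ 2) := fun k x => hχmul x (by
    refine (abs_sub _ _).trans (add_le_add ?_ ?_) <;> rw [abs_pow]
    · exact pow_le_pow_left₀ (abs_nonneg _) (hpb k x) 2
    · exact pow_le_pow_left₀ (abs_nonneg _) (hrb k x.2) 2)
  have hgi := hbound _ hgm hgb
  have hψi := fun k => hbound _ (hψm k) (hψb k)
  have hci := fun k => hbound _ (hcm k) (hcb k)
  have hEv : ∀ k : s × ∀ j, T j, MeasurableSet (othersEvent i k.1.1 k.2) := fun k =>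
    measurableSet_othersEvent i k.1.1 k.2
  have hset : MeasurableSet {w : (∀ j, Report T s j) × (∀ j, E j) × (∀ j, T j) |
      w.1 i = b ∧ w.2.2 i = t} :=
    MeasurableSet.inter
      ((by fun_prop : Measurable fun w : (∀ j, Report T s j) × (∀ j, E j) × (∀ j, T j) => w.1 i)
        (measurableSet_singleton b))
      ((by fun_prop : Measurable fun w : (∀ j, Report T s j) × (∀ j, E j) × (∀ j, T j) => w.2.2 i)
        (measurableSet_singleton t))
  have hout : Measurable fun w : (∀ j, E j) × (∀ j, T j) => (truth T s w, w.1, w.2) := by fun_prop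
  have hmeas := (integrable_deviation (T := T) (ν := J.map fun w => (truth T s w, w.1, w.2))
    (measurable_pay (s := s) (δ := δ) hq i) (exists_abs_pay_le hδ hq0 hq1 i) hφ
    ⟨D, fun e => by rw [abs_of_nonneg (hφ0 e)]; exact hD e⟩ (fun _ => a)).aestronglyMeasurable
  rw [← integral_indicator hset, integral_map hout.aemeasurable (hmeas.indicator hset)]
  calc _ = ∫ w, (g (w.2 i, w.1 i) + ∑ k, ((othersEvent i k.1.1 k.2).indicator
          (fun w => ψ k (w.2 i, w.1 i)) w + c k (w.2 i, w.1 i))) ∂J := by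
        congr 1
        ext w
        by_cases hw : truth T s w i = b ∧ w.2 i = t
        · have hx : χ (w.2 i, w.1 i) = φ (w.1 i) := Set.indicator_of_mem (s := Z) hw _
          rw [Set.indicator_of_mem (show (truth T s w, w.1, w.2) ∈
            {w : (∀ j, Report T s j) × (∀ j, E j) × (∀ j, T j) | w.1 i = b ∧ w.2.2 i = t} from hw)]
          simp only [g, ψ, c, hx, pay, Function.update_self, othersReport_update,
            othersReport_truth]
          have hcell : (truth T s w i).cell = cellOf s i (w.1 i) := rfl
          have hfc : ∀ k, forecast q δ i k (truth T s w i) (w.1 i) = p k (w.2 i, w.1 i) :=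
            fun k => by
              simp only [forecast, truth, shiftBy_none, add_zero, p]
          rw [if_pos hcell, add_sub_add_comm, ← Finset.sum_sub_distrib, mul_add, Finset.mul_sum]
          congr 1
          refine Finset.sum_congr rfl fun k _ => ?_
          rw [hfc k]
          by_cases hk : w ∈ othersEvent i k.1.1 k.2
          · simp only [hk, Set.indicator_of_mem, hx, r]
            ring
          · simp only [hk, Set.indicator_of_notMem, not_false_eq_true, r]
            ring
        · have hx : χ (w.2 i, w.1 i) = 0 := Set.indicator_of_notMem (s := Z) hw _
          rw [Set.indicator_of_notMem (show (truth T s w, w.1, w.2) ∉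
            {w : (∀ j, Report T s j) × (∀ j, E j) × (∀ j, T j) | w.1 i = b ∧ w.2.2 i = t} from hw)]
          simp [g, ψ, c, hx, Set.indicator_apply]
    _ = ∫ w, g (w.2 i, w.1 i) ∂J + ∑ k, (∫ w, (othersEvent i k.1.1 k.2).indicator
          (fun w => ψ k (w.2 i, w.1 i)) w ∂J + ∫ w, c k (w.2 i, w.1 i) ∂J) := by
        have hsum : ∀ k : s × ∀ j, T j, Integrable (fun w => (othersEvent i k.1.1 k.2).indicator
            (fun w => ψ k (w.2 i, w.1 i)) w + c k (w.2 i, w.1 i)) J := fun k =>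
          ((hψi k).indicator (hEv k)).add (hci k)
        rw [integral_add hgi (integrable_finsetSum _ fun k _ => hsum k),
          integral_finsetSum _ fun k _ => hsum k]
        congr 1
        refine Finset.sum_congr rfl fun k _ => ?_
        rw [integral_add ((hψi k).indicator (hEv k)) (hci k)]
    _ ≤ 0 := by
        refine add_nonpos (integral_nonpos fun w => ?_) (Finset.sum_nonpos fun k _ => ?_)
        · refine mul_nonpos_of_nonneg_of_nonpos (hχ0 _) ?_
          split_ifs <;> norm_num
        · have h := setIntegral_comp_eq_integral_mul_condProb hI (hEv k) (hqJ i k.1.1 k.2)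
            (hψm k) ⟨_, hψb k⟩
          have hψp : Integrable (fun w : (∀ j, E j) × (∀ j, T j) =>
              ψ k (w.2 i, w.1 i) * p k (w.2 i, w.1 i)) J :=
            hbound (u := fun x => ψ k x * p k x) (D * (2 * ((1 + δ) + 1)) * 1)
              ((hψm k).mul (hp k)) fun x => by
                rw [abs_mul]
                exact mul_le_mul (hψb k x) (hpb k x) (abs_nonneg _)
                  ((abs_nonneg _).trans (hψb k x))
          rw [integral_indicator (hEv k), h, ← integral_add hψp (hci k)]
          refine integral_nonpos fun w => ?_
          -- The expected loss in the quadratic score is the squared distance of the forecasts.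
          have hsq : ψ k (w.2 i, w.1 i) * p k (w.2 i, w.1 i) + c k (w.2 i, w.1 i) =
              -(χ (w.2 i, w.1 i) * (r k (w.1 i) - p k (w.2 i, w.1 i)) ^ 2) := by
            simp only [ψ, c]
            ring
          change ψ k (w.2 i, w.1 i) * p k (w.2 i, w.1 i) + c k (w.2 i, w.1 i) ≤ 0
          rw [hsq]
          exact neg_nonpos.2 (mul_nonneg (hχ0 _) (sq_nonneg _))

end Report

end ReportGame

/-! ### Equilibria of the reporting game -/

namespace Report

variable {N : Type*} [Fintype N] [DecidableEq N] {E : N → Type*} [∀ i, MeasurableSpace (E i)]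
  {T : N → Type*} {s : Finset (Rect E)} [∀ i, Fintype (T i)] [∀ i, MeasurableSpace (T i)]
  [∀ i, DiscreteMeasurableSpace (T i)]
  {q : ∀ i, Rect E → (∀ j, T j) → T i × E i → ℝ} {δ : ℝ}

/-- The outcomes of the reporting game when the players have signals in `T₂`. -/
abbrev ReportOutcome (T T₂ : N → Type*) (s : Finset (Rect E)) : Type _ :=
  (∀ i, Report T s i) × (∀ i, E i) × (∀ i, T₂ i)

open Classical in
theorem pay_update_cell_sub (i : N) (y : ∀ j, Report T s j) (c : Set s) (e : E i) :
    pay q δ i (Function.update y i ⟨c, (y i).signal, (y i).shift⟩) e - pay q δ i y e =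
      (if c = cellOf s i e then 1 else 0) - if (y i).cell = cellOf s i e then 1 else 0 := by
  simp only [pay, Function.update_self, othersReport_update, forecast]
  ring

open Classical in
theorem pay_update_shift_sub (i : N) (y : ∀ j, Report T s j) (hy : (y i).shift = none)
    (k : s × ∀ j, T j) (up : Bool) (e : E i) :
    pay q δ i (Function.update y i ⟨(y i).cell, (y i).signal, some (k, up)⟩) e - pay q δ i y e =
      2 * (if up then δ else -δ) * (othersReport i k y - q i k.1.1 k.2 ((y i).signal, e)) -
        δ ^ 2 := by
  simp only [pay, Function.update_self, othersReport_update, forecast, hy, shiftBy_none, add_zero]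
  rw [add_sub_add_left_eq_sub, ← Finset.sum_sub_distrib, Finset.sum_eq_single k]
  · cases up <;> simp [shiftBy] <;> ring
  · intro k' _ hk'
    have : shiftBy δ (some (k, up)) k' = 0 := by
      simp [shiftBy, hk'.symm]
    rw [this]
    ring
  · simp

variable {T₂ : N → Type*} [∀ i, Fintype (T₂ i)] [∀ i, MeasurableSpace (T₂ i)]
  [∀ i, DiscreteMeasurableSpace (T₂ i)]
  {ν : Measure (ReportOutcome T T₂ s)} [IsProbabilityMeasure ν]

/-- Reporting the true cell is strictly dominant. -/
theorem ae_cell_eq (hδ : 0 ≤ δ) (hq : ∀ i R t, Measurable (q i R t))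
    (hq0 : ∀ i R t x, 0 ≤ q i R t x) (hq1 : ∀ i R t x, q i R t x ≤ 1)
    (h : Obedient (pay q δ) ν) (i : N) :
    ∀ᵐ w ∂ν, (w.1 i).cell = cellOf s i (w.2.1 i) := by
  classical
  have key : ∀ (c : Set s) (t : T₂ i), ∀ᵐ w ∂ν, w.2.2 i = t → cellOf s i (w.2.1 i) = c →
      (w.1 i).cell = cellOf s i (w.2.1 i) := by
    intro c t
    -- On the types whose true cell is `c`, the deviation to reporting `c` never hurts, and gains a
    -- unit unless the report is `c` already.
    let φ : E i → ℝ := (cellOf s i ⁻¹' {c}).indicator fun _ => 1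
    have hφ : Measurable φ :=
      measurable_const.indicator (measurable_cellOf i (measurableSet_singleton c))
    have hφ0 : ∀ e, 0 ≤ φ e := fun e => Set.indicator_nonneg (fun _ _ => zero_le_one) e
    have hφ1 : ∀ e, φ e ≤ 1 := fun e => Set.indicator_le_self' (fun _ _ => zero_le_one) e
    have hset : MeasurableSet {w : ReportOutcome T T₂ s |
        w.1 i ∈ Set.univ ∧ w.2.2 i = t} :=
      (MeasurableSet.const _).inter
        ((by fun_prop : Measurable fun w : ReportOutcome T T₂ s =>
          w.2.2 i) (measurableSet_singleton t))
    have h1 := h.setIntegral_deviation_nonpos (measurable_pay hq i)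
      (exists_abs_pay_le hδ hq0 hq1 i) hφ hφ0 ⟨1, hφ1⟩
      (fun a => ⟨c, a.signal, a.shift⟩) Set.univ t
    have hint := integrable_deviation (ν := ν) (measurable_pay (s := s) (δ := δ) hq i)
      (exists_abs_pay_le hδ hq0 hq1 i) hφ
      ⟨1, fun e => by rw [abs_of_nonneg (hφ0 e)]; exact hφ1 e⟩
      (fun a => ⟨c, a.signal, a.shift⟩)
    simp only [pay_update_cell_sub] at h1 hint
    have hnn : ∀ w : ReportOutcome T T₂ s, 0 ≤ φ (w.2.1 i) *
        ((if c = cellOf s i (w.2.1 i) then 1 else 0) -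
          if (w.1 i).cell = cellOf s i (w.2.1 i) then 1 else 0) := fun w => by
      by_cases hc : cellOf s i (w.2.1 i) = c
      · refine mul_nonneg (hφ0 _) ?_
        rw [if_pos hc.symm]
        split_ifs <;> norm_num
      · have : φ (w.2.1 i) = 0 :=
          Set.indicator_of_notMem (s := cellOf s i ⁻¹' {c}) hc _
        rw [this, zero_mul]
    have h2 := (setIntegral_eq_zero_iff_of_nonneg_ae (ae_of_all _ hnn) hint.integrableOn).1
      (le_antisymm h1 (integral_nonneg hnn))
    rw [Filter.EventuallyEq, ae_restrict_iff' hset] at h2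
    filter_upwards [h2] with w hw ht hc
    have h3 := hw ⟨trivial, ht⟩
    have h4 : φ (w.2.1 i) = 1 := Set.indicator_of_mem (s := cellOf s i ⁻¹' {c}) hc _
    rw [h4, if_pos hc.symm] at h3
    by_contra hne
    simp [hne] at h3
  filter_upwards [ae_all_iff.2 fun c => ae_all_iff.2 fun t => key c t] with w hw
  exact hw _ _ rfl rfl

/-- No profitable shift: the forecasts that go with the reported signals are accurate up to `δ / 2`,
conditionally on the reported signal, the own type and the own signal. -/
theorem abs_setIntegral_forecast_error_le (hδ : 0 < δ) (hq : ∀ i R t, Measurable (q i R t))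
    (hq0 : ∀ i R t x, 0 ≤ q i R t x) (hq1 : ∀ i R t x, q i R t x ≤ 1)
    (h : Obedient (pay q δ) ν) (i : N) (hshift : ∀ᵐ w ∂ν, (w.1 i).shift = none)
    (k : s × ∀ j, T j) {φ : E i → ℝ} (hφ : Measurable φ) (hφ0 : ∀ e, 0 ≤ φ e)
    (hφ1 : ∀ e, φ e ≤ 1) (t : T i) (t₂ : T₂ i) :
    |∫ w in {w | (w.1 i).signal = t ∧ w.2.2 i = t₂}, φ (w.2.1 i) *
      (othersReport i k w.1 - q i k.1.1 k.2 (t, w.2.1 i)) ∂ν| ≤ δ / 2 := by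
  let Z : Set (ReportOutcome T T₂ s) := {w | (w.1 i).signal = t ∧ w.2.2 i = t₂}
  have hZ : MeasurableSet Z := by
    refine MeasurableSet.inter ?_ ?_
    · exact (Measurable.comp (g := fun a : Report T s i => a.signal) (measurable_of_countable _)
        (by fun_prop : Measurable fun w : ReportOutcome T T₂ s => w.1 i))
        (measurableSet_singleton t)
    · exact (by fun_prop : Measurable fun w : ReportOutcome T T₂ s => w.2.2 i)
        (measurableSet_singleton t₂)
  let B : Set (Report T s i) := {a | a.signal = t ∧ a.shift = none}
  have hZB : (Z : Set (ReportOutcome T T₂ s)) =ᵐ[ν]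
      {w : ReportOutcome T T₂ s | w.1 i ∈ B ∧ w.2.2 i = t₂} := by
    refine eventuallyEq_set.2 ?_
    filter_upwards [hshift] with w hw
    exact ⟨fun h => ⟨⟨h.1, hw⟩, h.2⟩, fun h => ⟨h.1.1, h.2⟩⟩
  let g : ReportOutcome T T₂ s → ℝ := fun w =>
    φ (w.2.1 i) * (othersReport i k w.1 - q i k.1.1 k.2 (t, w.2.1 i))
  have hg : Integrable g ν := by
    have hm : Measurable g := by
      have h1 : Measurable (othersReport (T := T) (s := s) i k) := measurable_of_countable _
      have h2 := hq i k.1.1 k.2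
      fun_prop
    refine Integrable.of_bound hm.aestronglyMeasurable (1 * (1 + 1)) (ae_of_all _ fun w => ?_)
    rw [norm_mul, Real.norm_of_nonneg (hφ0 _)]
    refine mul_le_mul (hφ1 _) ((abs_sub _ _).trans (add_le_add ?_ ?_)) (norm_nonneg _) zero_le_one
    · rw [abs_of_nonneg (othersReport_nonneg _ _ _)]
      exact othersReport_le_one _ _ _
    · rw [abs_of_nonneg (hq0 _ _ _ _)]
      exact hq1 _ _ _ _
  have hφi : Integrable (fun w : ReportOutcome T T₂ s => φ (w.2.1 i)) ν :=
    Integrable.of_bound (hφ.comp (by fun_prop : Measurable fun w : ReportOutcome T T₂ s =>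
      w.2.1 i)).aestronglyMeasurable 1 (ae_of_all _ fun w => by
        rw [Real.norm_of_nonneg (hφ0 _)]
        exact hφ1 _)
  have hφle : ∫ w in Z, φ (w.2.1 i) ∂ν ≤ 1 := by
    have h1 : ∫ w in Z, φ (w.2.1 i) ∂ν ≤ ∫ _w in Z, (1 : ℝ) ∂ν :=
      integral_mono hφi.integrableOn (integrable_const _) fun w => hφ1 _
    refine h1.trans ?_
    rw [setIntegral_const, smul_eq_mul, mul_one]
    exact measureReal_le_one
  -- A shift by `±δ` changes the score by `±2δ` times the forecast error, minus `δ ^ 2`.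
  have key : ∀ up : Bool, 2 * (if up then δ else -δ) * ∫ w in Z, g w ∂ν ≤ δ ^ 2 := by
    intro up
    have h1 := h.setIntegral_deviation_nonpos (measurable_pay hq i)
      (exists_abs_pay_le hδ.le hq0 hq1 i) hφ hφ0 ⟨1, hφ1⟩
      (fun a => ⟨a.cell, a.signal, some (k, up)⟩) B t₂
    have h2 : ∫ w in {w : ReportOutcome T T₂ s | w.1 i ∈ B ∧ w.2.2 i = t₂}, φ (w.2.1 i) *
        (pay q δ i (Function.update w.1 i ⟨(w.1 i).cell, (w.1 i).signal, some (k, up)⟩) (w.2.1 i) -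
          pay q δ i w.1 (w.2.1 i)) ∂ν =
        ∫ w in Z, (2 * (if up then δ else -δ) * g w - δ ^ 2 * φ (w.2.1 i)) ∂ν := by
      rw [setIntegral_congr_set hZB]
      have hm : MeasurableSet {w : ReportOutcome T T₂ s | w.1 i ∈ B ∧ w.2.2 i = t₂} :=
        MeasurableSet.inter
          ((by fun_prop : Measurable fun w : ReportOutcome T T₂ s => w.1 i)
            (MeasurableSet.of_discrete (s := B)))
          ((by fun_prop : Measurable fun w : ReportOutcome T T₂ s => w.2.2 i)
            (measurableSet_singleton t₂))
      refine setIntegral_congr_fun hm fun w hw => ?_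
      have h3 := pay_update_shift_sub (q := q) (δ := δ) i w.1 hw.1.2 k up (w.2.1 i)
      rw [hw.1.1] at h3
      simp only [g]
      rw [hw.1.1, h3]
      ring
    rw [h2, integral_sub (hg.integrableOn.const_mul _) (hφi.integrableOn.const_mul _),
      integral_const_mul, integral_const_mul] at h1
    have h3 := mul_le_mul_of_nonneg_left hφle (sq_nonneg δ)
    linarith
  have h1 := key true
  have h2 := key false
  simp only [if_true, Bool.false_eq_true, if_false] at h1 h2
  change |∫ w in Z, g w ∂ν| ≤ δ / 2
  rw [abs_le]
  constructor <;> nlinarith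

end Report

/-! ### Approximate combinations -/

section Approximation

variable {N : Type*} [Fintype N] [DecidableEq N] {E : N → Type*} [∀ i, MeasurableSpace (E i)]
  {F : Measure (∀ i, E i)} [IsProbabilityMeasure F] {S₁ S₂ : InfoStructure N E}

/-- The event that the type profile lies in the rectangle `R` and the signal profile is `t`. -/
def rectEvent {T : N → Type*} (R : Rect E) (t : ∀ j, T j) : Set ((∀ j, E j) × (∀ j, T j)) :=
  {w | (∀ j, w.1 j ∈ (R j).1) ∧ w.2 = t}

theorem measurableSet_rectEvent {T : N → Type*} [∀ i, MeasurableSpace (T i)]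
    [∀ i, Finite (T i)] [∀ i, DiscreteMeasurableSpace (T i)] (R : Rect E) (t : ∀ j, T j) :
    MeasurableSet (rectEvent R t) := by
  refine MeasurableSet.inter ?_ (measurable_snd (measurableSet_singleton t))
  have h : {w : (∀ j, E j) × (∀ j, T j) | ∀ j, w.1 j ∈ (R j).1} = ⋂ j, {w | w.1 j ∈ (R j).1} := by
    ext w
    simp
  change MeasurableSet {w : (∀ j, E j) × (∀ j, T j) | ∀ j, w.1 j ∈ (R j).1}
  rw [h]
  exact MeasurableSet.iInter fun j =>
    (by fun_prop : Measurable fun w : (∀ j, E j) × (∀ j, T j) => w.1 j) (R j).2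

/-- The difference between the indicator of the opponents' event and its forecast `q`, for own types
in `R i`. -/
noncomputable def forecastError {T : N → Type*} (q : ∀ i, Rect E → (∀ j, T j) → T i × E i → ℝ)
    (i : N) (R : Rect E) (t : ∀ j, T j) (w : (∀ j, E j) × (∀ j, T j)) : ℝ :=
  (R i).1.indicator (fun _ => 1) (w.1 i) *
    ((Report.othersEvent i R t).indicator (fun _ => 1) w - q i R t (t i, w.1 i))

theorem measurable_forecastError {T : N → Type*} [∀ i, MeasurableSpace (T i)]
    [∀ i, Finite (T i)] [∀ i, DiscreteMeasurableSpace (T i)]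
    {q : ∀ i, Rect E → (∀ j, T j) → T i × E i → ℝ} (hq : ∀ i R t, Measurable (q i R t))
    (i : N) (R : Rect E) (t : ∀ j, T j) : Measurable (forecastError q i R t) := by
  have h1 : Measurable ((R i).1.indicator fun _ => (1 : ℝ)) := measurable_const.indicator (R i).2
  have h2 : Measurable ((Report.othersEvent i R t).indicator fun _ => (1 : ℝ)) :=
    measurable_const.indicator (Report.measurableSet_othersEvent i R t)
  have h3 := hq i R t
  unfold forecastError
  fun_prop

theorem abs_forecastError_le {T : N → Type*} {q : ∀ i, Rect E → (∀ j, T j) → T i × E i → ℝ}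
    (hq0 : ∀ i R t x, 0 ≤ q i R t x) (hq1 : ∀ i R t x, q i R t x ≤ 1)
    (i : N) (R : Rect E) (t : ∀ j, T j) (w : (∀ j, E j) × (∀ j, T j)) :
    |forecastError q i R t w| ≤ 1 := by
  classical
  unfold forecastError
  have h0 := hq0 i R t (t i, w.1 i)
  have h1 := hq1 i R t (t i, w.1 i)
  simp only [Set.indicator_apply]
  split_ifs <;> rw [abs_le] <;> constructor <;> linarith

/-- If the predictions under `S₁` are predictions under `S₂`, then the reporting game yields laws of
types and pairs of signals that are consistent with `S₂`, have the right probabilities of the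
rectangles in `s` with the signals of `S₁`, and under which the signals of `S₂` improve the
forecasts of the signals of `S₁` by little. -/
theorem exists_approximate_combination
    (H : ∀ G : BasicGame N E, bcePredictions F G S₁ ⊆ bcePredictions F G S₂)
    {q : ∀ i, Rect E → (∀ j, S₁.T j) → S₁.T i × E i → ℝ} (hq : ∀ i R t, Measurable (q i R t))
    (hq0 : ∀ i R t x, 0 ≤ q i R t x) (hq1 : ∀ i R t x, q i R t x ≤ 1)
    (hqJ : ∀ i R t, (F ⊗ₘ S₁.law)⟦Report.othersEvent i R t | MeasurableSpace.comap
      (fun w : (∀ j, E j) × (∀ j, S₁.T j) => (w.2 i, w.1 i)) inferInstance⟧ =ᵐ[F ⊗ₘ S₁.law]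
        fun w => q i R t (w.2 i, w.1 i))
    (s : Finset (Rect E)) {δ : ℝ} (hδ : 0 < δ) :
    ∃ lam : Measure ((∀ i, E i) × (∀ i, S₁.T i × S₂.T i)),
      lam.map (fun w => (w.1, fun j => (w.2 j).2)) = F ⊗ₘ S₂.law ∧
      (∀ R ∈ s, ∀ t, (lam.map fun w => (w.1, fun j => (w.2 j).1)).real (rectEvent R t) =
        (F ⊗ₘ S₁.law).real (rectEvent R t)) ∧
      ∀ R ∈ s, ∀ (i : N) (t : ∀ j, S₁.T j) (t₂ : S₂.T i),
        |∫ w in {w | (w.2 i).1 = t i ∧ (w.2 i).2 = t₂},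
          forecastError q i R t (w.1, fun j => (w.2 j).1) ∂lam| ≤ δ / 2 := by
  have htruth := Report.measurable_truth (E := E) (T := S₁.T) (s := s)
  set J := F ⊗ₘ S₁.law
  have hout : Measurable fun w : (∀ j, E j) × (∀ j, S₁.T j) =>
      (Report.truth S₁.T s w, w.1, w.2) := by fun_prop
  have hν₁ : IsProbabilityMeasure (J.map fun w => (Report.truth S₁.T s w, w.1, w.2)) :=
    Measure.isProbabilityMeasure_map hout.aemeasurable
  obtain ⟨ν, hν, hcons, hob, hmarg⟩ := exists_obedient_of_bcePredictions_subset H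
    (Report.pay (s := s) q δ) (Report.measurable_pay hq)
    (J.map fun w => (Report.truth S₁.T s w, w.1, w.2))
    (by
      rw [Measure.map_map measurable_snd hout]
      exact Measure.map_id)
    (Report.obedient_truth hδ.le J hq hq0 hq1 hqJ)
  rw [Measure.map_map measurable_fst hout] at hmarg
  change ν.map Prod.fst = J.map (Report.truth S₁.T s) at hmarg
  have hcell : ∀ᵐ w ∂ν, ∀ i, (w.1 i).cell = Report.cellOf s i (w.2.1 i) :=
    ae_all_iff.2 fun i => Report.ae_cell_eq hδ.le hq hq0 hq1 hob i
  -- The truthful prediction contains no shifts.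
  have hshift : ∀ i, ∀ᵐ w ∂ν, (w.1 i).shift = none := fun i => by
    have h : ∀ᵐ y ∂(ν.map Prod.fst), (y i).shift = none := by
      rw [hmarg, ae_map_iff htruth.aemeasurable .of_discrete]
      exact ae_of_all _ fun w => rfl
    exact ae_of_ae_map measurable_fst.aemeasurable h
  have hsig : ∀ i, Measurable fun a : Report S₁.T s i => a.signal := fun i =>
    measurable_of_countable _
  let out : Report.ReportOutcome S₁.T S₂.T s → (∀ i, E i) × (∀ i, S₁.T i × S₂.T i) :=
    fun w => (w.2.1, fun i => ((w.1 i).signal, w.2.2 i))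
  have hout₂ : Measurable out := by
    have := hsig
    fun_prop
  refine ⟨ν.map out, ?_, fun R hR t => ?_, fun R hR i t t₂ => ?_⟩
  · rw [← hcons, Measure.map_map (by fun_prop) hout₂]
    rfl
  · have hm : Measurable fun w : (∀ i, E i) × (∀ i, S₁.T i × S₂.T i) =>
        (w.1, fun j => (w.2 j).1) := by fun_prop
    let Y : Set (∀ i, Report S₁.T s i) := {y | ∀ j, (⟨R, hR⟩ : s) ∈ (y j).cell ∧ (y j).signal = t j}
    have h1 : (ν.map Prod.fst).real Y = J.real (rectEvent R t) := by
      rw [hmarg, map_measureReal_apply htruth .of_discrete]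
      congr 1
      ext w
      change (∀ j, w.1 j ∈ (R j).1 ∧ w.2 j = t j) ↔ (∀ j, w.1 j ∈ (R j).1) ∧ w.2 = t
      rw [forall_and, funext_iff]
    rw [← h1, Measure.map_map hm hout₂, map_measureReal_apply (hm.comp hout₂)
      (measurableSet_rectEvent R t), map_measureReal_apply measurable_fst .of_discrete]
    refine measureReal_congr (eventuallyEq_set.2 ?_)
    filter_upwards [hcell] with w hw
    change ((∀ j, w.2.1 j ∈ (R j).1) ∧ (fun j => (w.1 j).signal) = t) ↔
      ∀ j, (⟨R, hR⟩ : s) ∈ (w.1 j).cell ∧ (w.1 j).signal = t j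
    rw [forall_and, funext_iff]
    simp only [hw]
    rfl
  · have hset : MeasurableSet {w : (∀ i, E i) × (∀ i, S₁.T i × S₂.T i) |
        (w.2 i).1 = t i ∧ (w.2 i).2 = t₂} :=
      MeasurableSet.inter
        ((by fun_prop : Measurable fun w : (∀ i, E i) × (∀ i, S₁.T i × S₂.T i) => (w.2 i).1)
          (measurableSet_singleton (t i)))
        ((by fun_prop : Measurable fun w : (∀ i, E i) × (∀ i, S₁.T i × S₂.T i) => (w.2 i).2)
          (measurableSet_singleton t₂))
    have hm : Measurable fun w : (∀ i, E i) × (∀ i, S₁.T i × S₂.T i) =>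
        forecastError q i R t (w.1, fun j => (w.2 j).1) :=
      (measurable_forecastError hq i R t).comp (by fun_prop)
    rw [setIntegral_map hset hm.aestronglyMeasurable hout₂.aemeasurable]
    have h1 := Report.abs_setIntegral_forecast_error_le hδ hq hq0 hq1 hob i (hshift i) (⟨R, hR⟩, t)
      (φ := (R i).1.indicator fun _ => 1) (measurable_const.indicator (R i).2)
      (fun e => Set.indicator_nonneg (fun _ _ => zero_le_one) e)
      (fun e => Set.indicator_le_self' (fun _ _ => zero_le_one) e) (t i) t₂
    refine le_of_eq_of_le (congrArg _ (integral_congr_ae ?_)) h1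
    refine ae_restrict_of_ae ?_
    filter_upwards [hcell] with w hw
    have h2 : Report.othersReport i ((⟨R, hR⟩, t) : s × ∀ j, S₁.T j) w.1 =
        (Report.othersEvent i R t).indicator (fun _ => 1) (w.2.1, fun j => (w.1 j).signal) := by
      refine Set.indicator_eq_indicator (forall_congr' fun j => forall_congr' fun _ => ?_) rfl
      rw [hw j]
      rfl
    rw [h2]
    rfl

end Approximation

/-! ### Measures determined by rectangles -/

section Rectangles

variable {N : Type*} [Fintype N] {E : N → Type*} [∀ i, MeasurableSpace (E i)]

/-- Finite measures on types and finitely many signals are determined by the rectangles. -/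
theorem measure_ext_of_rectEvent {T : N → Type*} [∀ i, MeasurableSpace (T i)]
    [∀ i, Fintype (T i)] [∀ i, DiscreteMeasurableSpace (T i)]
    {μ ν : Measure ((∀ i, E i) × (∀ i, T i))} [IsFiniteMeasure μ] [IsFiniteMeasure ν]
    (h : ∀ R t, μ (rectEvent R t) = ν (rectEvent R t)) : μ = ν := by
  classical
  have hsing : ∀ t : ∀ i, T i, MeasurableSet (Prod.snd ⁻¹' {t} : Set ((∀ i, E i) × (∀ i, T i))) :=
    fun t => measurable_snd (measurableSet_singleton t)
  have hslice : ∀ t, (μ.restrict (Prod.snd ⁻¹' {t})).map Prod.fst =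
      (ν.restrict (Prod.snd ⁻¹' {t})).map Prod.fst := by
    intro t
    have key : ∀ R : Rect E, (μ.restrict (Prod.snd ⁻¹' {t})).map Prod.fst
        (Set.univ.pi fun i => (R i).1) =
        (ν.restrict (Prod.snd ⁻¹' {t})).map Prod.fst (Set.univ.pi fun i => (R i).1) := fun R => by
      have hR : MeasurableSet (Set.univ.pi fun i => (R i).1) :=
        MeasurableSet.univ_pi fun i => (R i).2
      rw [Measure.map_apply measurable_fst hR, Measure.map_apply measurable_fst hR,
        Measure.restrict_apply (measurable_fst hR), Measure.restrict_apply (measurable_fst hR)]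
      have hset : Prod.fst ⁻¹' (Set.univ.pi fun i => (R i).1) ∩ Prod.snd ⁻¹' {t} =
          rectEvent R t := by
        ext w
        simp [rectEvent]
      rw [hset, h R t]
    refine ext_of_generate_finite _ generateFrom_pi.symm isPiSystem_pi ?_ ?_
    · rintro _ ⟨B, hB, rfl⟩
      exact key fun i => ⟨B i, hB i trivial⟩
    · simpa using key fun i => ⟨Set.univ, .univ⟩
  ext C hC
  have hdecomp : ∀ ρ : Measure ((∀ i, E i) × (∀ i, T i)), ρ C = ∑ t,
      (ρ.restrict (Prod.snd ⁻¹' {t})).map Prod.fst ((fun e => (e, t)) ⁻¹' C) := fun ρ => by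
    have h1 : C = ⋃ t, C ∩ Prod.snd ⁻¹' {t} := by
      ext w
      simp
    conv_lhs => rw [h1]
    rw [measure_iUnion _ fun t => hC.inter (hsing t), tsum_fintype]
    · refine Finset.sum_congr rfl fun t _ => ?_
      have hCt : MeasurableSet ((fun e : ∀ i, E i => (e, t)) ⁻¹' C) :=
        measurable_prodMk_right hC
      rw [Measure.map_apply measurable_fst hCt, Measure.restrict_apply (measurable_fst hCt)]
      congr 1
      ext ⟨e, t'⟩
      simp only [Set.mem_inter_iff, Set.mem_preimage, Set.mem_singleton_iff]
      constructor <;> rintro ⟨h2, rfl⟩ <;> exact ⟨h2, rfl⟩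
    · intro t t' htt'
      exact Set.disjoint_left.2 fun w hw hw' => htt' (hw.2.symm.trans hw'.2)
  rw [hdecomp, hdecomp]
  exact Finset.sum_congr rfl fun t _ => by rw [hslice t]

/-- A measure with first marginal `F` and finitely many values of the second coordinate is dominated
by the product of `F` and the counting measure. -/
theorem le_prod_count {X P : Type*} [MeasurableSpace X] [Fintype P] [MeasurableSpace P]
    [DiscreteMeasurableSpace P] {lam : Measure (X × P)} {F : Measure X} [SFinite F]
    (h : lam.map Prod.fst = F) : lam ≤ F.prod Measure.count := by
  refine Measure.le_iff.2 fun C hC => ?_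
  have hCp : ∀ p, MeasurableSet ((fun x : X => (x, p)) ⁻¹' C) := fun p => measurable_prodMk_right hC
  rw [Measure.prod_apply_symm hC, lintegral_count, tsum_fintype]
  calc lam C ≤ lam (⋃ p ∈ Finset.univ, Prod.fst ⁻¹' ((fun x : X => (x, p)) ⁻¹' C)) := by
        refine measure_mono fun w hw => ?_
        simp only [Finset.mem_univ, Set.iUnion_true, Set.mem_iUnion]
        exact ⟨w.2, hw⟩
    _ ≤ ∑ p, lam (Prod.fst ⁻¹' ((fun x : X => (x, p)) ⁻¹' C)) := measure_biUnion_finset_le _ _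
    _ = ∑ p, F ((fun x : X => (x, p)) ⁻¹' C) :=
        Finset.sum_congr rfl fun p _ => by rw [← h, Measure.map_apply measurable_fst (hCp p)]

end Rectangles

/-! ### The limiting combination -/

section Exact

variable {N : Type*} [Fintype N] [DecidableEq N] {E : N → Type*} [∀ i, MeasurableSpace (E i)]
  {F : Measure (∀ i, E i)} [IsProbabilityMeasure F] {S₁ S₂ : InfoStructure N E}

/-- The limit of the approximate combinations, along an ultrafilter that refines the finite sets of
rectangles and lets the forecast errors tend to zero. -/
theorem exists_exact_combination_law
    (H : ∀ G : BasicGame N E, bcePredictions F G S₁ ⊆ bcePredictions F G S₂)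
    {q : ∀ i, Rect E → (∀ j, S₁.T j) → S₁.T i × E i → ℝ} (hq : ∀ i R t, Measurable (q i R t))
    (hq0 : ∀ i R t x, 0 ≤ q i R t x) (hq1 : ∀ i R t x, q i R t x ≤ 1)
    (hqJ : ∀ i R t, (F ⊗ₘ S₁.law)⟦Report.othersEvent i R t | MeasurableSpace.comap
      (fun w : (∀ j, E j) × (∀ j, S₁.T j) => (w.2 i, w.1 i)) inferInstance⟧ =ᵐ[F ⊗ₘ S₁.law]
        fun w => q i R t (w.2 i, w.1 i)) :
    ∃ lam : Measure ((∀ i, E i) × (∀ i, S₁.T i × S₂.T i)), IsFiniteMeasure lam ∧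
      lam.map (fun w => (w.1, fun j => (w.2 j).2)) = F ⊗ₘ S₂.law ∧
      lam.map (fun w => (w.1, fun j => (w.2 j).1)) = F ⊗ₘ S₁.law ∧
      ∀ (R : Rect E) (i : N) (t : ∀ j, S₁.T j) (t₂ : S₂.T i),
        ∫ w in {w | (w.2 i).1 = t i ∧ (w.2 i).2 = t₂},
          forecastError q i R t (w.1, fun j => (w.2 j).1) ∂lam = 0 := by
  have hpos : ∀ n : ℕ, (0 : ℝ) < 1 / ((n : ℝ) + 1) := fun n => Nat.one_div_pos_of_nat
  choose lam h₂ h₁ herr using fun n : Finset (Rect E) × ℕ =>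
    exists_approximate_combination H hq hq0 hq1 hqJ n.1 (hpos n.2)
  let M : Measure ((∀ i, E i) × (∀ i, S₁.T i × S₂.T i)) := F.prod Measure.count
  have hle : ∀ n, lam n ≤ M := fun n => by
    refine le_prod_count ?_
    have h : (lam n).map Prod.fst =
        ((lam n).map fun w => (w.1, fun j => (w.2 j).2)).map Prod.fst := by
      rw [Measure.map_map measurable_fst (by fun_prop)]
      rfl
    rw [h, h₂ n, ← Measure.fst, Measure.fst_compProd]
  let U : Ultrafilter (Finset (Rect E) × ℕ) := Ultrafilter.of atTop
  have hU : (U : Filter (Finset (Rect E) × ℕ)) ≤ atTop := Ultrafilter.of_le _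
  obtain ⟨L, hL, hlim⟩ := exists_measure_tendsto_of_le M lam hle U
  have hmem : ∀ R : Rect E, ∀ᶠ n in (U : Filter (Finset (Rect E) × ℕ)), R ∈ n.1 := fun R =>
    hU <| (eventually_ge_atTop (({R}, 0) : Finset (Rect E) × ℕ)).mono fun n hn =>
      hn.1 (Finset.mem_singleton_self R)
  have hLfin : IsFiniteMeasure L := isFiniteMeasure_of_le M hL
  have hfin : ∀ n, IsFiniteMeasure (lam n) := fun n => isFiniteMeasure_of_le M (hle n)
  have hm₁ : Measurable fun w : (∀ i, E i) × (∀ i, S₁.T i × S₂.T i) =>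
      (w.1, fun j => (w.2 j).1) := by fun_prop
  have hm₂ : Measurable fun w : (∀ i, E i) × (∀ i, S₁.T i × S₂.T i) =>
      (w.1, fun j => (w.2 j).2) := by fun_prop
  refine ⟨L, hLfin, ?_, ?_, fun R i t t₂ => ?_⟩
  · ext C hC
    rw [← measureReal_eq_measureReal_iff, map_measureReal_apply hm₂ hC]
    refine tendsto_nhds_unique (hlim _ (hm₂ hC)) ?_
    refine tendsto_const_nhds.congr fun n => ?_
    rw [← h₂ n, map_measureReal_apply hm₂ hC]
  · refine measure_ext_of_rectEvent fun R t => ?_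
    have hC := measurableSet_rectEvent R t
    rw [← measureReal_eq_measureReal_iff, map_measureReal_apply hm₁ hC]
    refine tendsto_nhds_unique (hlim _ (hm₁ hC)) ?_
    refine tendsto_const_nhds.congr' ?_
    filter_upwards [hmem R] with n hn
    rw [← h₁ n R hn t, map_measureReal_apply hm₁ hC]
  · have hset : MeasurableSet {w : (∀ i, E i) × (∀ i, S₁.T i × S₂.T i) |
        (w.2 i).1 = t i ∧ (w.2 i).2 = t₂} :=
      MeasurableSet.inter
        ((by fun_prop : Measurable fun w : (∀ i, E i) × (∀ i, S₁.T i × S₂.T i) => (w.2 i).1)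
          (measurableSet_singleton (t i)))
        ((by fun_prop : Measurable fun w : (∀ i, E i) × (∀ i, S₁.T i × S₂.T i) => (w.2 i).2)
          (measurableSet_singleton t₂))
    have hint : Integrable (fun w : (∀ i, E i) × (∀ i, S₁.T i × S₂.T i) =>
        forecastError q i R t (w.1, fun j => (w.2 j).1)) M :=
      Integrable.of_bound ((measurable_forecastError hq i R t).comp hm₁).aestronglyMeasurable 1
        (ae_of_all _ fun w => abs_forecastError_le hq0 hq1 i R t _)
    have ht := tendsto_integral_of_tendsto_measureReal hle hL hlim (hint.indicator hset)
    simp only [integral_indicator hset] at ht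
    refine tendsto_nhds_unique ht (squeeze_zero_norm' (a := fun n : Finset (Rect E) × ℕ =>
      1 / ((n.2 : ℝ) + 1)) ?_ ?_)
    · filter_upwards [hmem R] with n hn
      exact (herr n R hn i t t₂).trans (half_le_self (hpos n.2).le)
    · have h : Tendsto (fun n : Finset (Rect E) × ℕ => n.2) atTop atTop := by
        rw [← prod_atTop_atTop_eq]
        exact tendsto_snd
      exact (tendsto_one_div_add_atTop_nhds_zero_nat.comp h).mono_left hU

/-- Vanishing forecast errors turn the conditional probability `g` of a set of `S₂`-signals of
player `i`, given the own type and own `S₁`-signal, into the conditional probability on each rectangle. -/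
theorem measureReal_rectEvent_inter_eq {lam : Measure ((∀ i, E i) × (∀ i, S₁.T i × S₂.T i))}
    [IsFiniteMeasure lam]
    {q : ∀ i, Rect E → (∀ j, S₁.T j) → S₁.T i × E i → ℝ} (hq : ∀ i R t, Measurable (q i R t))
    (hq0 : ∀ i R t x, 0 ≤ q i R t x) (hq1 : ∀ i R t x, q i R t x ≤ 1)
    (hqJ : ∀ i R t, (F ⊗ₘ S₁.law)⟦Report.othersEvent i R t | MeasurableSpace.comap
      (fun w : (∀ j, E j) × (∀ j, S₁.T j) => (w.2 i, w.1 i)) inferInstance⟧ =ᵐ[F ⊗ₘ S₁.law]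
        fun w => q i R t (w.2 i, w.1 i))
    (h₁ : lam.map (fun w => (w.1, fun j => (w.2 j).1)) = F ⊗ₘ S₁.law)
    (herr : ∀ (R : Rect E) (i : N) (t : ∀ j, S₁.T j) (t₂ : S₂.T i),
        ∫ w in {w | (w.2 i).1 = t i ∧ (w.2 i).2 = t₂},
          forecastError q i R t (w.1, fun j => (w.2 j).1) ∂lam = 0)
    {i : N} {A : Set (S₂.T i)} {g : S₁.T i × E i → ℝ} (hg : Measurable g) (hg0 : ∀ x, 0 ≤ g x)
    (hg1 : ∀ x, g x ≤ 1)
    (hge : lam⟦{w : (∀ j, E j) × (∀ j, S₁.T j × S₂.T j) | (w.2 i).2 ∈ A} |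
      MeasurableSpace.comap (fun w => ((w.2 i).1, w.1 i)) inferInstance⟧
        =ᵐ[lam] fun w => g ((w.2 i).1, w.1 i)) (R : Rect E) (t : ∀ j, S₁.T j) :
    lam.real ((fun w => (w.1, fun j => (w.2 j).1)) ⁻¹' rectEvent R t ∩ {w | (w.2 i).2 ∈ A}) =
      ∫ w in (fun w => (w.1, fun j => (w.2 j).1)) ⁻¹' rectEvent R t, g ((w.2 i).1, w.1 i) ∂lam := by
  classical
  let pr : (∀ i, E i) × (∀ i, S₁.T i × S₂.T i) → (∀ i, E i) × (∀ i, S₁.T i) :=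
    fun w => (w.1, fun j => (w.2 j).1)
  have hpr : Measurable pr := by fun_prop
  have hI : Measurable fun w : (∀ i, E i) × (∀ i, S₁.T i × S₂.T i) => ((w.2 i).1, w.1 i) := by
    fun_prop
  have hI' : Measurable fun w : (∀ i, E i) × (∀ i, S₁.T i) => (w.2 i, w.1 i) := by fun_prop
  let s : Set ((∀ i, E i) × (∀ i, S₁.T i × S₂.T i)) := {w | (w.2 i).2 ∈ A}
  have hs : MeasurableSet s :=
    (by fun_prop : Measurable fun w : (∀ i, E i) × (∀ i, S₁.T i × S₂.T i) => (w.2 i).2)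
      (MeasurableSet.of_discrete (s := A))
  have hEv := Report.measurableSet_othersEvent (T := S₁.T) i R t
  have hrm := measurableSet_rectEvent (T := S₁.T) R t
  let Z : Set (S₁.T i × E i) := {x | x.1 = t i ∧ x.2 ∈ (R i).1}
  have hZ : MeasurableSet Z :=
    (measurable_fst (measurableSet_singleton (t i))).inter (measurable_snd (R i).2)
  let χ : S₁.T i × E i → ℝ := Z.indicator fun _ => 1
  have hχ : Measurable χ := measurable_const.indicator hZ
  have hχ0 : ∀ x, 0 ≤ χ x := fun x => Set.indicator_nonneg (fun _ _ => zero_le_one) x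
  have hχ1 : ∀ x, χ x ≤ 1 := fun x => Set.indicator_le_self' (fun _ _ => zero_le_one) x
  have hmul : ∀ {u v : S₁.T i × E i → ℝ}, (∀ x, 0 ≤ u x) → (∀ x, u x ≤ 1) → (∀ x, 0 ≤ v x) →
      (∀ x, v x ≤ 1) → ∃ C, ∀ x, |u x * v x| ≤ C := fun hu0 hu1 hv0 hv1 =>
    ⟨1, fun x => by
      rw [abs_of_nonneg (mul_nonneg (hu0 x) (hv0 x))]
      exact mul_le_one₀ (hu1 x) (hv0 x) (hv1 x)⟩
  have hmem : ∀ w, w ∈ rectEvent R t ↔ w ∈ Report.othersEvent i R t ∧ (w.2 i, w.1 i) ∈ Z := by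
    intro w
    simp only [rectEvent, Report.othersEvent, Z, Set.mem_ofPred_eq, funext_iff]
    constructor
    · exact fun h => ⟨fun j _ => ⟨h.1 j, h.2 j⟩, h.2 i, h.1 i⟩
    · refine fun h => ⟨fun j => ?_, fun j => ?_⟩ <;> by_cases hj : j = i
      · exact hj ▸ h.2.2
      · exact (h.1 j hj).1
      · exact hj ▸ h.2.1
      · exact (h.1 j hj).2
  have hind : ∀ w, (rectEvent R t).indicator (fun _ => (1 : ℝ)) w =
      (Report.othersEvent i R t).indicator (fun _ => 1) w * χ (w.2 i, w.1 i) := by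
    intro w
    by_cases h1 : w ∈ Report.othersEvent i R t <;> by_cases h2 : (w.2 i, w.1 i) ∈ Z <;>
      simp [χ, hmem, h1, h2]
  -- The forecast errors for the signals in `A` add up to zero.
  have hzero : ∫ w in s, ((rectEvent R t).indicator (fun _ => (1 : ℝ)) (pr w) -
      χ ((w.2 i).1, w.1 i) * q i R t ((w.2 i).1, w.1 i)) ∂lam = 0 := by
    have hset : ∀ t₂, MeasurableSet {w : (∀ i, E i) × (∀ i, S₁.T i × S₂.T i) |
        (w.2 i).1 = t i ∧ (w.2 i).2 = t₂} := fun t₂ =>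
      MeasurableSet.inter
        ((by fun_prop : Measurable fun w : (∀ i, E i) × (∀ i, S₁.T i × S₂.T i) => (w.2 i).1)
          (measurableSet_singleton (t i)))
        ((by fun_prop : Measurable fun w : (∀ i, E i) × (∀ i, S₁.T i × S₂.T i) => (w.2 i).2)
          (measurableSet_singleton t₂))
    have hint : Integrable (fun w : (∀ i, E i) × (∀ i, S₁.T i × S₂.T i) =>
        forecastError q i R t (w.1, fun j => (w.2 j).1)) lam :=
      Integrable.of_bound ((measurable_forecastError hq i R t).comp hpr).aestronglyMeasurable 1
        (ae_of_all _ fun w => abs_forecastError_le hq0 hq1 i R t _)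
    calc _ = ∫ w, ∑ t₂ ∈ A.toFinset, {w : (∀ i, E i) × (∀ i, S₁.T i × S₂.T i) |
          (w.2 i).1 = t i ∧ (w.2 i).2 = t₂}.indicator
            (fun w => forecastError q i R t (w.1, fun j => (w.2 j).1)) w ∂lam := by
          rw [← integral_indicator hs]
          congr 1
          ext w
          simp only [hind]
          by_cases h1 : (w.2 i).1 = t i
          · simp only [Set.indicator_apply, Set.mem_ofPred_eq, h1, true_and,
              Finset.sum_ite_eq, Set.mem_toFinset, s, pr, χ, Z, forecastError]
            split_ifs <;> simp
          · simp [Set.indicator_apply, h1, χ, Z, pr]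
      _ = 0 := by
          rw [integral_finsetSum _ fun t₂ _ => hint.indicator (hset t₂)]
          refine Finset.sum_eq_zero fun t₂ _ => ?_
          rw [integral_indicator (hset t₂)]
          exact herr R i t t₂
  have hχq : Integrable (fun w : (∀ i, E i) × (∀ i, S₁.T i × S₂.T i) =>
      χ ((w.2 i).1, w.1 i) * q i R t ((w.2 i).1, w.1 i)) lam := by
    obtain ⟨C, hC⟩ := hmul hχ0 hχ1 (hq0 i R t) (hq1 i R t)
    exact Integrable.of_bound ((hχ.mul (hq i R t)).comp hI).aestronglyMeasurable C
      (ae_of_all _ fun w => hC _)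
  have hrecti : Integrable (fun w => (rectEvent R t).indicator (fun _ => (1 : ℝ)) (pr w)) lam :=
    (integrable_const (1 : ℝ)).indicator (hpr hrm)
  rw [integral_sub hrecti.integrableOn hχq.integrableOn, sub_eq_zero] at hzero
  -- Under `lam`, replace the opponents' event by its forecast and the event `s` by `g`; then undo
  -- the first replacement under the law of types and `S₁`-signals.
  calc lam.real (pr ⁻¹' rectEvent R t ∩ s)
      = ∫ w in s, (pr ⁻¹' rectEvent R t).indicator (fun _ => (1 : ℝ)) w ∂lam := by
        rw [integral_indicator_const _ (hpr hrm), smul_eq_mul, mul_one,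
          measureReal_restrict_apply (hpr hrm)]
    _ = ∫ w in s, χ ((w.2 i).1, w.1 i) * q i R t ((w.2 i).1, w.1 i) ∂lam := hzero
    _ = ∫ w, (χ ((w.2 i).1, w.1 i) * g ((w.2 i).1, w.1 i)) * q i R t ((w.2 i).1, w.1 i) ∂lam := by
        rw [setIntegral_comp_eq_integral_mul_condProb (ψ := fun x => χ x * q i R t x) hI hs hge
          (hχ.mul (hq i R t)) (hmul hχ0 hχ1 (hq0 i R t) (hq1 i R t))]
        congr 1
        ext w
        ring
    _ = ∫ w, (χ (w.2 i, w.1 i) * g (w.2 i, w.1 i)) * q i R t (w.2 i, w.1 i)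
          ∂(F ⊗ₘ S₁.law) := by
        have hm := (((hχ.mul hg).mul (hq i R t)).comp hI').aestronglyMeasurable
          (μ := lam.map pr)
        rw [← h₁]
        exact (integral_map hpr.aemeasurable hm).symm
    _ = ∫ w in Report.othersEvent i R t, χ (w.2 i, w.1 i) * g (w.2 i, w.1 i)
          ∂(F ⊗ₘ S₁.law) :=
        (setIntegral_comp_eq_integral_mul_condProb (ψ := fun x => χ x * g x) hI' hEv
          (hqJ i R t) (hχ.mul hg) (hmul hχ0 hχ1 hg0 hg1)).symm
    _ = ∫ w in pr ⁻¹' Report.othersEvent i R t,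
          χ ((w.2 i).1, w.1 i) * g ((w.2 i).1, w.1 i) ∂lam := by
        have hm := ((hχ.mul hg).comp hI').aestronglyMeasurable (μ := lam.map pr)
        rw [← h₁]
        exact setIntegral_map hEv hm hpr.aemeasurable
    _ = ∫ w in pr ⁻¹' rectEvent R t, g ((w.2 i).1, w.1 i) ∂lam := by
        rw [← integral_indicator (hpr hEv), ← integral_indicator (hpr hrm)]
        congr 1
        ext w
        have h := hmem (pr w)
        change _ ↔ _ ∧ ((w.2 i).1, w.1 i) ∈ Z at h
        by_cases h1 : pr w ∈ Report.othersEvent i R t <;> by_cases h2 : ((w.2 i).1, w.1 i) ∈ Z <;>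
          simp [χ, Set.indicator_apply, h, h1, h2]

/-- Vanishing forecast errors mean that the signal of `S₂` of player `i` is independent of the types
and the `S₁`-signals of the opponents, conditionally on the own type and own `S₁`-signal. -/
theorem condProb_signal_ae_eq {lam : Measure ((∀ i, E i) × (∀ i, S₁.T i × S₂.T i))}
    [IsFiniteMeasure lam]
    {q : ∀ i, Rect E → (∀ j, S₁.T j) → S₁.T i × E i → ℝ} (hq : ∀ i R t, Measurable (q i R t))
    (hq0 : ∀ i R t x, 0 ≤ q i R t x) (hq1 : ∀ i R t x, q i R t x ≤ 1)
    (hqJ : ∀ i R t, (F ⊗ₘ S₁.law)⟦Report.othersEvent i R t | MeasurableSpace.comap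
      (fun w : (∀ j, E j) × (∀ j, S₁.T j) => (w.2 i, w.1 i)) inferInstance⟧ =ᵐ[F ⊗ₘ S₁.law]
        fun w => q i R t (w.2 i, w.1 i))
    (h₁ : lam.map (fun w => (w.1, fun j => (w.2 j).1)) = F ⊗ₘ S₁.law)
    (herr : ∀ (R : Rect E) (i : N) (t : ∀ j, S₁.T j) (t₂ : S₂.T i),
        ∫ w in {w | (w.2 i).1 = t i ∧ (w.2 i).2 = t₂},
          forecastError q i R t (w.1, fun j => (w.2 j).1) ∂lam = 0)
    (i : N) (A : Set (S₂.T i)) :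
    lam⟦{w : (∀ j, E j) × (∀ j, S₁.T j × S₂.T j) | (w.2 i).2 ∈ A} |
          MeasurableSpace.comap (fun w => ((fun j => (w.2 j).1 : ∀ j, S₁.T j), w.1))
            inferInstance⟧
        =ᵐ[lam]
      lam⟦{w : (∀ j, E j) × (∀ j, S₁.T j × S₂.T j) | (w.2 i).2 ∈ A} |
          MeasurableSpace.comap (fun w => ((w.2 i).1, w.1 i)) inferInstance⟧ := by
  let pr : (∀ i, E i) × (∀ i, S₁.T i × S₂.T i) → (∀ i, E i) × (∀ i, S₁.T i) :=
    fun w => (w.1, fun j => (w.2 j).1)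
  have hpr : Measurable pr := by fun_prop
  have hI : Measurable fun w : (∀ i, E i) × (∀ i, S₁.T i × S₂.T i) => ((w.2 i).1, w.1 i) := by
    fun_prop
  let s : Set ((∀ i, E i) × (∀ i, S₁.T i × S₂.T i)) := {w | (w.2 i).2 ∈ A}
  have hs : MeasurableSet s :=
    (by fun_prop : Measurable fun w : (∀ i, E i) × (∀ i, S₁.T i × S₂.T i) => (w.2 i).2)
      (MeasurableSet.of_discrete (s := A))
  obtain ⟨g, hg, hg0, hg1, hge⟩ := exists_measurable_comp_eq_condProb (μ := lam) hI hs
  have hgI : Integrable (fun w : (∀ i, E i) × (∀ i, S₁.T i × S₂.T i) =>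
      g ((w.2 i).1, w.1 i)) lam :=
    Integrable.of_bound (hg.comp hI).aestronglyMeasurable 1 (ae_of_all _ fun w => by
      rw [Real.norm_of_nonneg (hg0 _)]
      exact hg1 _)
  have hrect := fun R t =>
    measureReal_rectEvent_inter_eq hq hq0 hq1 hqJ h₁ herr hg hg0 hg1 hge R t
  -- Rectangles determine the laws of types and `S₁`-signals.
  have hmeas : (lam.restrict s).map pr =
      (lam.withDensity fun w => ENNReal.ofReal (g ((w.2 i).1, w.1 i))).map pr := by
    have hfin : IsFiniteMeasure
        (lam.withDensity fun w => ENNReal.ofReal (g ((w.2 i).1, w.1 i))) :=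
      isFiniteMeasure_withDensity_ofReal hgI.2
    refine measure_ext_of_rectEvent fun R t => ?_
    have hrm := measurableSet_rectEvent (T := S₁.T) R t
    rw [Measure.map_apply hpr hrm, Measure.map_apply hpr hrm, Measure.restrict_apply (hpr hrm),
      withDensity_apply _ (hpr hrm), ← ofReal_integral_eq_lintegral_ofReal hgI.integrableOn
        (ae_of_all _ fun w => hg0 _), ← hrect R t, ofReal_measureReal]
  refine (condProb_ae_eq_of_forall_setIntegral_eq (q := fun x => g (x.1 i, x.2 i))
    (I := fun w : (∀ j, E j) × (∀ j, S₁.T j × S₂.T j) =>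
      ((fun j => (w.2 j).1 : ∀ j, S₁.T j), w.1)) (by fun_prop) hs (by fun_prop)
    ⟨1, fun x => ?_⟩ fun B hB => ?_).trans hge.symm
  · rw [abs_of_nonneg (hg0 _)]
    exact hg1 _
  · have hB' : MeasurableSet (pr ⁻¹' (Prod.swap ⁻¹' B)) := hpr (measurable_swap hB)
    have h := congrArg (fun μ => μ (Prod.swap ⁻¹' B)) hmeas
    rw [Measure.map_apply hpr (measurable_swap hB), Measure.map_apply hpr (measurable_swap hB),
      Measure.restrict_apply hB', withDensity_apply _ hB',
      ← ofReal_integral_eq_lintegral_ofReal hgI.integrableOn (ae_of_all _ fun w => hg0 _)] at h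
    rw [Set.inter_comm, measureReal_def]
    change _ = (lam (pr ⁻¹' (Prod.swap ⁻¹' B) ∩ s)).toReal
    rw [h, ENNReal.toReal_ofReal (integral_nonneg fun w => hg0 _)]
    rfl

/-- The combination is obtained by disintegrating the limiting law over the types. -/
theorem ownType_of_bcePredictions_subset
    (H : ∀ G : BasicGame N E, bcePredictions F G S₁ ⊆ bcePredictions F G S₂) :
    IndividuallySufficientOwnType F S₁ S₂ := by
  choose q hq hq0 hq1 hqJ using fun (i : N) (R : Rect E) (t : ∀ j, S₁.T j) =>
    exists_measurable_comp_eq_condProb (μ := F ⊗ₘ S₁.law)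
      (I := fun w : (∀ j, E j) × (∀ j, S₁.T j) => (w.2 i, w.1 i)) (by fun_prop)
      (Report.measurableSet_othersEvent i R t)
  obtain ⟨lam, hfin, h₂, h₁, herr⟩ := exists_exact_combination_law H hq hq0 hq1 hqJ
  have hf₁ : Measurable fun (p : ∀ i, S₁.T i × S₂.T i) j => (p j).1 := by fun_prop
  have hf₂ : Measurable fun (p : ∀ i, S₁.T i × S₂.T i) j => (p j).2 := by fun_prop
  have hne : Nonempty (∀ i, S₁.T i × S₂.T i) := by
    obtain ⟨w⟩ := (F ⊗ₘ S₁.law).nonempty_of_neZero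
    obtain ⟨w'⟩ := (F ⊗ₘ S₂.law).nonempty_of_neZero
    exact ⟨fun i => (w.2 i, w'.2 i)⟩
  have hfst : lam.fst = F := by
    have h : lam.fst = (lam.map fun w => (w.1, fun j => (w.2 j).1)).fst := by
      rw [Measure.fst, Measure.fst, Measure.map_map measurable_fst (by fun_prop)]
      rfl
    rw [h, h₁, Measure.fst_compProd]
  let κ := lam.condKernel
  have hκ : F ⊗ₘ κ = lam := by
    rw [← hfst]
    exact lam.disintegrate _
  have hae₁ : κ.map (fun p j => (p j).1) =ᵐ[F] S₁.law := by
    refine Kernel.ae_eq_of_compProd_eq ?_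
    rw [Measure.compProd_map hf₁, hκ, ← h₁]
    rfl
  have hae₂ : κ.map (fun p j => (p j).2) =ᵐ[F] S₂.law := by
    refine Kernel.ae_eq_of_compProd_eq ?_
    rw [Measure.compProd_map hf₂, hκ, ← h₂]
    rfl
  -- On a null set of type profiles, the marginals of `κ` may be wrong: there, the signals of the
  -- two structures are drawn independently.
  obtain ⟨D, hsub, hD, hDnull⟩ := exists_measurable_superset_of_null (hae₁.and hae₂)
  let zip : (∀ i, S₁.T i) × (∀ i, S₂.T i) → ∀ i, S₁.T i × S₂.T i := fun p i => (p.1 i, p.2 i)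
  have hzip : Measurable zip := by fun_prop
  let ind : Kernel (∀ i, E i) (∀ i, S₁.T i × S₂.T i) := (S₁.law ×ₖ S₂.law).map zip
  have hind : IsMarkovKernel ind := Kernel.IsMarkovKernel.map _ hzip
  have hind₁ : ind.map (fun p j => (p j).1) = S₁.law := by
    rw [← Kernel.map_comp_right _ hzip hf₁]
    exact (Kernel.fst_eq _).symm.trans (Kernel.fst_prod _ _)
  have hind₂ : ind.map (fun p j => (p j).2) = S₂.law := by
    rw [← Kernel.map_comp_right _ hzip hf₂]
    exact (Kernel.snd_eq _).symm.trans (Kernel.snd_prod _ _)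
  classical
  let K : Kernel (∀ i, E i) (∀ i, S₁.T i × S₂.T i) := Kernel.piecewise hD ind κ
  have hK₁ : ∀ ε, (K ε).map (fun p j => (p j).1) = S₁.law ε := fun ε => by
    by_cases hε : ε ∈ D
    · simp only [K, Kernel.piecewise_apply, hε, if_true]
      rw [← Kernel.map_apply _ hf₁, hind₁]
    · simp only [K, Kernel.piecewise_apply, hε, if_false]
      rw [← Kernel.map_apply _ hf₁]
      exact (not_not.1 fun hn => hε (hsub hn) : _ ∧ _).1
  have hK₂ : ∀ ε, (K ε).map (fun p j => (p j).2) = S₂.law ε := fun ε => by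
    by_cases hε : ε ∈ D
    · simp only [K, Kernel.piecewise_apply, hε, if_true]
      rw [← Kernel.map_apply _ hf₂, hind₂]
    · simp only [K, Kernel.piecewise_apply, hε, if_false]
      rw [← Kernel.map_apply _ hf₂]
      exact (not_not.1 fun hn => hε (hsub hn) : _ ∧ _).2
  have hKlam : F ⊗ₘ K = lam := by
    rw [← hκ]
    refine Measure.compProd_congr ?_
    filter_upwards [compl_mem_ae_iff.2 hDnull] with ε hε
    simp only [K, Kernel.piecewise_apply]
    rw [if_neg hε]
  refine ⟨K, ⟨inferInstance, fun ε t => ?_, fun ε t => ?_⟩, ?_⟩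
  · rw [sum_measure_zip_right, hK₁]
  · rw [sum_measure_zip_left, hK₂]
  · rw [hKlam]
    exact condProb_signal_ae_eq hq hq0 hq1 hqJ h₁ herr

end Exact

theorem proposition2 {N : Type*} [Fintype N] [DecidableEq N] {E : N → Type*}
    [∀ i, MeasurableSpace (E i)] (F : Measure (∀ i, E i)) [IsProbabilityMeasure F]
    (S₁ S₂ : InfoStructure N E) :
    (IndividuallySufficientOwnType F S₁ S₂ ↔
      ∀ G : BasicGame N E, bcePredictions F G S₁ ⊆ bcePredictions F G S₂) ∧
    (IndividuallySufficient F S₁ S₂ →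
      ∀ G : BasicGame N E, bcePredictions F G S₁ ⊆ bcePredictions F G S₂) ∧
    (RevealsOwnType F S₁ →
      (IndividuallySufficient F S₁ S₂ ↔
        ∀ G : BasicGame N E, bcePredictions F G S₁ ⊆ bcePredictions F G S₂)) := by
  have hiff : IndividuallySufficientOwnType F S₁ S₂ ↔
      ∀ G : BasicGame N E, bcePredictions F G S₁ ⊆ bcePredictions F G S₂ :=
    ⟨bcePredictions_subset_of_ownType, ownType_of_bcePredictions_subset⟩
  exact ⟨hiff, fun h => hiff.1 h.ownType, fun hr =>
    ⟨fun h => hiff.1 h.ownType, fun h => (hiff.2 h).of_revealsOwnType hr⟩⟩
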